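/- Let $n\ge 0$, let $\mathbb{R}\{x\}$, $x=(x_1,\dots,x_n)$, be the ring of convergent real power series at $0\in\mathbb{R}^n$, and let $\hat f,\hat g\in\mathbb{R}\{x\}\setminus\{0\}$ be relatively prime (every common divisor is a unit). Let $\hat f=u\prod_{i=1}^{\alpha}\hat f_i^{\,n_i}$ and $\hat g=v\prod_{j=1}^{\beta}\hat g_j^{\,m_j}$ be decompositions into irreducible factors ($u,v$ units, the $\hat f_i$ and the $\hat g_j$ irreducible and pairwise non-associated within each product, $n_i,m_j\ge 1$), put $\hat f^{\rm red}=\prod_i\hat f_i$, $\hat g^{\rm red}=\prod_j\hat g_j$, and associate with $\hat\varphi=\hat f/\hat g$ the real analytic $1$-form \[\hat\theta_{\hat\varphi}=\hat f^{\rm red}\,\hat g^{\rm red}\left(\frac{d\hat f}{\hat f}-\frac{d\hat g}{\hat g}\right).\] The algebraic singular set ${\rm Sing}_{alg}(\hat\theta)$ of a real analytic $1$-form $\hat\theta=\sum_k\hat\theta_k\,dx_k$ is the greatest common divisor of its coefficients $\hat\theta_k$ in $\mathbb{R}\{x\}$ (defined up to a unit). For an integer $\ell\ge 1$, an irreducible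 $\hat h\in\mathbb{R}\{x\}$ is a component of multiplicity $\ell$ of ${\rm Sing}_{alg}(\hat\theta)$ if $\hat h^{\ell}$ divides this greatest common divisor but $\hat h^{\ell+1}$ does not. Let $\hat h\in\mathbb{R}\{x\}$ be irreducible and let $\ell\ge 1$ be an integer. Then $\hat h$ is a component of ${\rm Sing}_{alg}(\hat\theta_{\hat\varphi})$ of multiplicity $\ell$ if and only if $\ell$ is the largest non-negative integer for which at least one of the following conditions holds: \begin{enumerate} \item there exist $c\in\mathbb{R}\setminus\{0\}$ and $\hat s\in\mathbb{R}\{x\}$ such that $\hat f-c\,\hat g=\hat h^{\ell+1}\hat s$; \item there exist $c\in\mathbb{C}\setminus\mathbb{R}$ and $\hat\rho_1,\hat\rho_2,\hat\varsigma_1,\hat\varsigma_2\in\mathbb{R}\{x\}$ such that $\hat h=\pm(\hat\rho_1^2+\hat\rho_2^2)$ and \[\hat f^2+|c|^2\hat g^2-2\,{\rm Re}(c)\,\hat f\hat g=(\hat\rho_1^2+\hat\rho_2^2)^{\ell+1}(\hat\varsigma_1^2+\hat\varsigma_2^2).\] \end{enumerate} -/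

import Mathlib

/-- A formal power series in `n` variables is convergent if it converges absolutely on some
polydisc of positive radius around the origin. -/
def IsConvergentSeries {𝕜 : Type*} [NormedField 𝕜] {n : ℕ}
    (a : MvPowerSeries (Fin n) 𝕜) : Prop :=
  ∃ r : ℝ, 0 < r ∧
    Summable fun ν : Fin n →₀ ℕ => ‖MvPowerSeries.coeff ν a‖ * r ^ ν.degree

namespace IsConvergentSeries

variable {𝕜 : Type*} [NormedField 𝕜] {n : ℕ}

theorem mono {a : MvPowerSeries (Fin n) 𝕜} {r s : ℝ} (hs : 0 < s) (hsr : s ≤ r)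
    (h : Summable fun ν : Fin n →₀ ℕ => ‖MvPowerSeries.coeff ν a‖ * r ^ ν.degree) :
    Summable fun ν : Fin n →₀ ℕ => ‖MvPowerSeries.coeff ν a‖ * s ^ ν.degree := by
  refine Summable.of_nonneg_of_le (fun ν => by positivity) (fun ν => ?_) h
  gcongr

theorem add {a b : MvPowerSeries (Fin n) 𝕜} (ha : IsConvergentSeries a)
    (hb : IsConvergentSeries b) : IsConvergentSeries (a + b) := by
  obtain ⟨r, hr, ha⟩ := ha
  obtain ⟨s, hs, hb⟩ := hb
  have hm : 0 < min r s := lt_min hr hs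
  refine ⟨min r s, hm, Summable.of_nonneg_of_le (fun ν => by positivity) (fun ν => ?_)
    ((mono hm (min_le_left r s) ha).add (mono hm (min_le_right r s) hb))⟩
  rw [← add_mul, map_add]
  gcongr
  exact norm_add_le _ _

theorem mul {a b : MvPowerSeries (Fin n) 𝕜} (ha : IsConvergentSeries a)
    (hb : IsConvergentSeries b) : IsConvergentSeries (a * b) := by
  classical
  obtain ⟨r, hr, ha⟩ := ha
  obtain ⟨s, hs, hb⟩ := hb
  have hm : 0 < min r s := lt_min hr hs
  have key := summable_sum_mul_antidiagonal_of_summable_mul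
    (Summable.mul_of_nonneg (mono hm (min_le_left r s) ha) (mono hm (min_le_right r s) hb)
      (fun ν => by positivity) (fun ν => by positivity))
  refine ⟨min r s, hm, Summable.of_nonneg_of_le (fun ν => by positivity) (fun ν => ?_) key⟩
  rw [MvPowerSeries.coeff_mul]
  refine (mul_le_mul_of_nonneg_right (norm_sum_le _ _) (by positivity)).trans ?_
  rw [Finset.sum_mul]
  refine Finset.sum_le_sum fun p hp => ?_
  rw [← Finset.HasAntidiagonal.mem_antidiagonal.mp hp, norm_mul, map_add, pow_add]
  exact le_of_eq (by ring)

theorem algebraMap (c : 𝕜) :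
    IsConvergentSeries (algebraMap 𝕜 (MvPowerSeries (Fin n) 𝕜) c) := by
  classical
  refine ⟨1, one_pos, summable_of_ne_finset_zero (s := {0}) fun ν hν => ?_⟩
  have hν : ν ≠ 0 := by simpa using hν
  simp [MvPowerSeries.algebraMap_apply, MvPowerSeries.coeff_C, hν]

theorem pderiv {a : MvPowerSeries (Fin n) 𝕜} (ha : IsConvergentSeries a) (i : Fin n) :
    IsConvergentSeries (MvPowerSeries.pderiv 𝕜 i a) := by
  obtain ⟨r, hr, ha⟩ := ha
  have hinj : Function.Injective fun ν : Fin n →₀ ℕ => ν + Finsupp.single i 1 :=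
    add_left_injective _
  have h1 := (ha.comp_injective hinj).mul_left (2 / r)
  refine ⟨r / 2, by positivity, Summable.of_nonneg_of_le (fun ν => by positivity)
    (fun ν => ?_) h1⟩
  have hle : ν i ≤ ν.degree := Finsupp.le_degree i ν
  have h2 : ((ν i : ℝ) + 1) ≤ 2 * 2 ^ ν.degree := by
    have : ν i + 1 ≤ 2 * 2 ^ ν.degree := by
      have := Nat.lt_two_pow_self (n := ν.degree)
      omega
    exact_mod_cast this
  have h3 : ‖((ν i : 𝕜) + 1)‖ ≤ (ν i : ℝ) + 1 := by
    have := Nat.norm_cast_le (α := 𝕜) (ν i + 1)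
    simpa using this
  have hdeg : (ν + Finsupp.single i 1).degree = ν.degree + 1 := by
    rw [map_add, Finsupp.degree_single]
  simp only [Function.comp_apply]
  rw [MvPowerSeries.coeff_pderiv, norm_mul, hdeg]
  calc _ ≤ ‖MvPowerSeries.coeff (ν + Finsupp.single i 1) a‖ * (2 * 2 ^ ν.degree)
          * (r / 2) ^ ν.degree := by
        gcongr
        exact h3.trans h2
    _ = _ := by
        rw [div_pow, pow_succ]
        field_simp

end IsConvergentSeries

/-- The ring `𝕜{x}`, `x = (x₁, …, xₙ)`, of convergent power series. -/
def ConvergentSeries (𝕜 : Type*) [NormedField 𝕜] (n : ℕ) :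
    Subalgebra 𝕜 (MvPowerSeries (Fin n) 𝕜) where
  carrier := {a | IsConvergentSeries a}
  mul_mem' := IsConvergentSeries.mul
  add_mem' := IsConvergentSeries.add
  algebraMap_mem' := IsConvergentSeries.algebraMap

namespace ConvergentSeries

/-- The partial derivative `∂/∂xᵢ` on `𝕜{x}`. -/
noncomputable def pderiv {𝕜 : Type*} [NormedField 𝕜] {n : ℕ} (i : Fin n)
    (a : ConvergentSeries 𝕜 n) : ConvergentSeries 𝕜 n :=
  ⟨MvPowerSeries.pderiv 𝕜 i a.1, IsConvergentSeries.pderiv a.2 i⟩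

/-- An analytic `1`-form germ `∑ₖ ωₖ dxₖ`, given by its coefficients `ωₖ ∈ 𝕜{x}`. -/
abbrev OneForm (𝕜 : Type*) [NormedField 𝕜] (n : ℕ) : Type _ :=
  Fin n → ConvergentSeries 𝕜 n

/-- The exterior derivative `da = ∑ₖ (∂a/∂xₖ) dxₖ`. -/
noncomputable def d {𝕜 : Type*} [NormedField 𝕜] {n : ℕ} (a : ConvergentSeries 𝕜 n) :
    OneForm 𝕜 n :=
  fun k => pderiv k a

/-- A decomposition `f = u · f₁ ^ n₁ ⋯ f_α ^ n_α` into irreducible factors, with `u` a unit, the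
`fᵢ` irreducible and pairwise non-associated, and `nᵢ ≥ 1`. -/
structure IrredDecomp {𝕜 : Type*} [NormedField 𝕜] {n : ℕ} (f : ConvergentSeries 𝕜 n) where
  α : ℕ
  u : (ConvergentSeries 𝕜 n)ˣ
  factor : Fin α → ConvergentSeries 𝕜 n
  exponent : Fin α → ℕ
  irreducible_factor : ∀ i, Irreducible (factor i)
  not_associated : ∀ i j, i ≠ j → ¬ Associated (factor i) (factor j)
  exponent_pos : ∀ i, 1 ≤ exponent i
  eq_prod : f = u * ∏ i, factor i ^ exponent i

namespace IrredDecomp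

variable {𝕜 : Type*} [NormedField 𝕜] {n : ℕ} {f g : ConvergentSeries 𝕜 n}

/-- The reduced equation `f_red = f₁ ⋯ f_α`. -/
noncomputable def red (F : IrredDecomp f) : ConvergentSeries 𝕜 n :=
  ∏ i, F.factor i

/-- The analytic `1`-form `f_red · df / f`, written without denominators: it is
`f_red · u⁻¹ du + ∑ᵢ nᵢ f₁ ⋯ f̂ᵢ ⋯ f_α dfᵢ` (the `i`-th factor is omitted in the product). -/
noncomputable def redLogDeriv (F : IrredDecomp f) : OneForm 𝕜 n :=
  (F.red * (F.u⁻¹ : (ConvergentSeries 𝕜 n)ˣ)) • d (F.u : ConvergentSeries 𝕜 n) +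
    ∑ i, (F.exponent i * ∏ j ∈ Finset.univ.erase i, F.factor j) • d (F.factor i)

/-- The `1`-form `θ_φ = f_red g_red (df / f - dg / g)` of `φ = f / g`. -/
noncomputable def theta (F : IrredDecomp f) (G : IrredDecomp g) : OneForm 𝕜 n :=
  G.red • F.redLogDeriv - F.red • G.redLogDeriv

end IrredDecomp

/-- `s` is (a representative of) the algebraic singular set of the `1`-form `ω`: a greatest common
divisor of the coefficients of `ω`. -/
def IsSingAlg {𝕜 : Type*} [NormedField 𝕜] {n : ℕ} (ω : OneForm 𝕜 n)
    (s : ConvergentSeries 𝕜 n) : Prop :=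
  (∀ k, s ∣ ω k) ∧ ∀ e : ConvergentSeries 𝕜 n, (∀ k, e ∣ ω k) → e ∣ s

/-- `h` is a component of multiplicity `ℓ` of the algebraic singular set of `ω`: an irreducible
factor of the greatest common divisor of the coefficients, occurring with exact exponent `ℓ ≥ 1`. -/
def IsSingAlgComponent {𝕜 : Type*} [NormedField 𝕜] {n : ℕ} (ω : OneForm 𝕜 n)
    (h : ConvergentSeries 𝕜 n) (l : ℕ) : Prop :=
  Irreducible h ∧ 1 ≤ l ∧ ∃ s, IsSingAlg ω s ∧ h ^ l ∣ s ∧ ¬ h ^ (l + 1) ∣ s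

/-- The condition `f - c g = h ^ (m + 1) s` for some real level `c ≠ 0`. -/
def RealLevel {n : ℕ} (f g h : ConvergentSeries ℝ n) (m : ℕ) : Prop :=
  ∃ (c : ℝ) (s : ConvergentSeries ℝ n), c ≠ 0 ∧ f - c • g = h ^ (m + 1) * s

/-- The condition that, up to sign, `h = ρ₁² + ρ₂²` and
`f² + |c|² g² - 2 Re(c) f g = (ρ₁² + ρ₂²) ^ (m + 1) (ς₁² + ς₂²)` for some non-real `c`. -/
def NonrealLevel {n : ℕ} (f g h : ConvergentSeries ℝ n) (m : ℕ) : Prop :=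
  ∃ (c : ℂ) (ρ₁ ρ₂ ς₁ ς₂ : ConvergentSeries ℝ n), c.im ≠ 0 ∧
    (h = ρ₁ ^ 2 + ρ₂ ^ 2 ∨ h = -(ρ₁ ^ 2 + ρ₂ ^ 2)) ∧
    f ^ 2 + (‖c‖ ^ 2) • g ^ 2 - (2 * c.re) • (f * g) =
      (ρ₁ ^ 2 + ρ₂ ^ 2) ^ (m + 1) * (ς₁ ^ 2 + ς₂ ^ 2)

end ConvergentSeries

/-! Let `W = g df - f dg`. Clearing denominators gives `f g θ = f_red g_red W` (`mul_theta`), so a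
prime `h` dividing neither `f` nor `g` occurs in `θ` and in `W` with the same multiplicity
(`pow_dvd_theta_iff`). A prime dividing one of `f`, `g` does not divide `θ` at all
(`exists_not_dvd_theta`). It remains to see, for the other primes and `m ≥ 1`, that `h ^ m ∣ W`
exactly when `f / g` is constant along `h` to order `m + 1`.

`W` does not change when `f` is replaced by `f - c g`. Hence `h ^ (m + 1) ∣ f - c g` gives `h ^ m ∣
W` by differentiating. Conversely, once `h ∣ f - c g`, the exponent climbs one step at a time up to
`m + 1` (`pow_succ_dvd_of_pow_dvd_wronskian`), because in characteristic zero a prime does not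
divide all its partial derivatives.

The level `c` itself is found over `ℂ` (`exists_dvd_sub_smul`). After a linear change of coordinates
`h` is a Weierstrass polynomial in `x₀`, so `f` and `g` satisfy a homogeneous relation modulo `h`
with coefficients in the remaining variables. Vector fields tangent to `h` annihilate `f / g` along
`h`, and they force the coefficients of a relation of minimal degree to be proportional to
constants. So `f / g` is algebraic over `ℂ` modulo `h`, hence constant.

To return to `ℝ`, take an irreducible complex factor `s` of `h`. If `c` is real, `h` itself divides
`f - c g`. If not, `s` and its conjugate are coprime, `h` is a unit times `s s̄ = ρ₁² + ρ₂²`, the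
unit is plus or minus a square, and taking norms of `f - c g` gives the quadratic identity
(`level_of_pow_dvd`).

Irreducibles must be prime for all this: `uniqueFactorizationMonoid` proves that `𝕜{x}` is factorial
through Weierstrass preparation, whose analytic core is a Neumann series in weighted `ℓ¹`-norms. -/

open scoped NNReal ENNReal

/-! ### Weighted `ℓ¹`-norms of power series -/

namespace MvPowerSeries

variable {𝕜 : Type*} [NormedField 𝕜] {n : ℕ}

/-- The weighted `ℓ¹`-norm `∑ ν, ‖f_ν‖ ρ ^ ν` of a power series, for a polyradius `ρ`. -/
noncomputable def polyNorm (ρ : Fin n → ℝ≥0) (f : MvPowerSeries (Fin n) 𝕜) : ℝ≥0∞ :=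
  ∑' ν : Fin n →₀ ℕ, ‖coeff ν f‖ₑ * ((∏ i, ρ i ^ ν i : ℝ≥0) : ℝ≥0∞)

theorem polyNorm_mono {ρ σ : Fin n → ℝ≥0} (h : ρ ≤ σ) (f : MvPowerSeries (Fin n) 𝕜) :
    polyNorm ρ f ≤ polyNorm σ f := by
  refine ENNReal.tsum_le_tsum fun ν => ?_
  gcongr with i
  exact h i

theorem polyNorm_add_le (ρ : Fin n → ℝ≥0) (f g : MvPowerSeries (Fin n) 𝕜) :
    polyNorm ρ (f + g) ≤ polyNorm ρ f + polyNorm ρ g := by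
  rw [polyNorm, polyNorm, polyNorm, ← ENNReal.tsum_add]
  refine ENNReal.tsum_le_tsum fun ν => ?_
  rw [← add_mul, map_add]
  gcongr
  exact enorm_add_le _ _

theorem polyNorm_neg (ρ : Fin n → ℝ≥0) (f : MvPowerSeries (Fin n) 𝕜) :
    polyNorm ρ (-f) = polyNorm ρ f := by
  simp [polyNorm]

theorem polyNorm_monomial (ρ : Fin n → ℝ≥0) (ν : Fin n →₀ ℕ) (c : 𝕜) :
    polyNorm ρ (monomial ν c) = ‖c‖ₑ * ((∏ i, ρ i ^ ν i : ℝ≥0) : ℝ≥0∞) := by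
  classical
  rw [polyNorm, tsum_eq_single ν]
  · simp
  · intro μ hμ
    simp [coeff_monomial_ne hμ]

theorem polyNorm_C (ρ : Fin n → ℝ≥0) (c : 𝕜) : polyNorm ρ (C c) = ‖c‖ₑ := by
  rw [← monomial_zero_eq_C_apply, polyNorm_monomial]
  simp

theorem polyNorm_X (ρ : Fin n → ℝ≥0) (i : Fin n) :
    polyNorm ρ (X i : MvPowerSeries (Fin n) 𝕜) = ρ i := by
  classical
  rw [X_def, polyNorm_monomial, Finset.prod_eq_single i]
  · simp
  · intro j _ hj
    simp [Finsupp.single_eq_of_ne hj]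
  · simp

/-- Triangle inequality on the Cauchy product, then regrouping of the double sum along
antidiagonals. Values in `[0, ∞]` make the regrouping unconditional. -/
theorem polyNorm_mul_le (ρ : Fin n → ℝ≥0) (f g : MvPowerSeries (Fin n) 𝕜) :
    polyNorm ρ (f * g) ≤ polyNorm ρ f * polyNorm ρ g := by
  classical
  calc polyNorm ρ (f * g)
      ≤ ∑' ν : Fin n →₀ ℕ, ∑' p : Finset.HasAntidiagonal.antidiagonal ν,
          (‖coeff p.1.1 f‖ₑ * ((∏ i, ρ i ^ p.1.1 i : ℝ≥0) : ℝ≥0∞)) *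
          (‖coeff p.1.2 g‖ₑ * ((∏ i, ρ i ^ p.1.2 i : ℝ≥0) : ℝ≥0∞)) := by
        refine ENNReal.tsum_le_tsum fun ν => ?_
        rw [Finset.tsum_subtype (Finset.HasAntidiagonal.antidiagonal ν)
          (fun p : (Fin n →₀ ℕ) × (Fin n →₀ ℕ) =>
          (‖coeff p.1 f‖ₑ * ((∏ i, ρ i ^ p.1 i : ℝ≥0) : ℝ≥0∞)) *
          (‖coeff p.2 g‖ₑ * ((∏ i, ρ i ^ p.2 i : ℝ≥0) : ℝ≥0∞))), coeff_mul]
        refine (mul_le_mul_left (enorm_sum_le _ _) _).trans ?_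
        rw [Finset.sum_mul]
        refine Finset.sum_le_sum fun p hp => ?_
        rw [← Finset.HasAntidiagonal.mem_antidiagonal.mp hp, enorm_mul]
        simp only [Finsupp.add_apply, pow_add, Finset.prod_mul_distrib, ENNReal.coe_mul]
        exact le_of_eq (by ring)
    _ = polyNorm ρ f * polyNorm ρ g := by
        rw [← ENNReal.tsum_sigma'
          (f := fun x : Σ ν : Fin n →₀ ℕ, Finset.HasAntidiagonal.antidiagonal ν =>
          (‖coeff x.2.1.1 f‖ₑ * ((∏ i, ρ i ^ x.2.1.1 i : ℝ≥0) : ℝ≥0∞)) *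
          (‖coeff x.2.1.2 g‖ₑ * ((∏ i, ρ i ^ x.2.1.2 i : ℝ≥0) : ℝ≥0∞))),
          ← Finset.HasAntidiagonal.sigmaAntidiagonalEquivProd.symm.tsum_eq]
        simp only [Finset.HasAntidiagonal.sigmaAntidiagonalEquivProd_symm_apply_snd_coe]
        rw [ENNReal.tsum_prod (f := fun a b : Fin n →₀ ℕ =>
          (‖coeff a f‖ₑ * ((∏ i, ρ i ^ a i : ℝ≥0) : ℝ≥0∞)) *
          (‖coeff b g‖ₑ * ((∏ i, ρ i ^ b i : ℝ≥0) : ℝ≥0∞)))]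
        simp only [ENNReal.tsum_mul_left, ENNReal.tsum_mul_right]
        rfl

theorem polyNorm_pow_le (ρ : Fin n → ℝ≥0) (f : MvPowerSeries (Fin n) 𝕜) (k : ℕ) :
    polyNorm ρ (f ^ k) ≤ polyNorm ρ f ^ k := by
  induction k with
  | zero => rw [pow_zero, pow_zero, ← map_one C, polyNorm_C]; simp
  | succ k ih =>
    rw [pow_succ, pow_succ]
    exact (polyNorm_mul_le _ _ _).trans (mul_le_mul_left ih _)

theorem polyNorm_prod_le {ι : Type*} (s : Finset ι) (ρ : Fin n → ℝ≥0)
    (f : ι → MvPowerSeries (Fin n) 𝕜) :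
    polyNorm ρ (∏ j ∈ s, f j) ≤ ∏ j ∈ s, polyNorm ρ (f j) := by
  classical
  induction s using Finset.induction_on with
  | empty => simp [← map_one (C : 𝕜 →+* MvPowerSeries (Fin n) 𝕜), polyNorm_C, -map_one]
  | insert a s ha ih =>
    rw [Finset.prod_insert ha, Finset.prod_insert ha]
    exact (polyNorm_mul_le _ _ _).trans (mul_le_mul_right ih _)

theorem enorm_coeff_mul_le_polyNorm (ρ : Fin n → ℝ≥0) (f : MvPowerSeries (Fin n) 𝕜)
    (ν : Fin n →₀ ℕ) :
    ‖coeff ν f‖ₑ * ((∏ i, ρ i ^ ν i : ℝ≥0) : ℝ≥0∞) ≤ polyNorm ρ f :=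
  ENNReal.le_tsum ν

theorem eq_zero_of_polyNorm_eq_zero {ρ : Fin n → ℝ≥0} (hρ : ∀ i, 0 < ρ i)
    {f : MvPowerSeries (Fin n) 𝕜} (h : polyNorm ρ f = 0) : f = 0 := by
  ext ν
  have h1 := enorm_coeff_mul_le_polyNorm ρ f ν
  rw [h, nonpos_iff_eq_zero, mul_eq_zero] at h1
  rcases h1 with h1 | h1
  · simpa using h1
  · rw [ENNReal.coe_eq_zero, Finset.prod_eq_zero_iff] at h1
    obtain ⟨i, -, hi⟩ := h1
    exact absurd hi (pow_pos (hρ i) _).ne'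

theorem polyNorm_const (r : ℝ≥0) (f : MvPowerSeries (Fin n) 𝕜) :
    polyNorm (fun _ => r) f = ∑' ν : Fin n →₀ ℕ, ‖coeff ν f‖ₑ * (r : ℝ≥0∞) ^ ν.degree := by
  refine tsum_congr fun ν => ?_
  rw [Finset.prod_pow_eq_pow_sum, Finsupp.degree_eq_sum, ENNReal.coe_pow]

theorem isConvergentSeries_iff {f : MvPowerSeries (Fin n) 𝕜} :
    IsConvergentSeries f ↔ ∃ r : ℝ≥0, 0 < r ∧ polyNorm (fun _ => r) f ≠ ∞ := by
  have key : ∀ r : ℝ≥0, polyNorm (fun _ => r) f ≠ ∞ ↔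
      Summable fun ν : Fin n →₀ ℕ => ‖coeff ν f‖ * (r : ℝ) ^ ν.degree := by
    intro r
    have h : ∀ ν : Fin n →₀ ℕ, ‖coeff ν f‖ₑ * (r : ℝ≥0∞) ^ ν.degree =
        ((‖coeff ν f‖₊ * r ^ ν.degree : ℝ≥0) : ℝ≥0∞) := fun ν => by
      rw [ENNReal.coe_mul, ENNReal.coe_pow]; rfl
    rw [polyNorm_const, tsum_congr h, ENNReal.tsum_coe_ne_top_iff_summable, ← NNReal.summable_coe]
    simp
  constructor
  · rintro ⟨r, hr, h⟩
    exact ⟨⟨r, hr.le⟩, hr, (key _).2 h⟩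
  · rintro ⟨r, hr, h⟩
    exact ⟨r, hr, (key _).1 h⟩

/-- The least radius of the polyradius serves as a common radius. Unequal radii are needed in
Weierstrass division, where `x₀` plays a special role. -/
theorem isConvergentSeries_of_polyNorm {ρ : Fin n → ℝ≥0} (hρ : ∀ i, 0 < ρ i)
    {f : MvPowerSeries (Fin n) 𝕜} (h : polyNorm ρ f ≠ ∞) : IsConvergentSeries f := by
  have : ∃ r : ℝ≥0, 0 < r ∧ ∀ i, r ≤ ρ i := by
    rcases isEmpty_or_nonempty (Fin n) with he | he
    · exact ⟨1, one_pos, fun i => he.elim i⟩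
    · obtain ⟨i, hi⟩ := Finite.exists_min ρ
      exact ⟨ρ i, hρ i, hi⟩
  obtain ⟨r, hr, hle⟩ := this
  exact isConvergentSeries_iff.2 ⟨r, hr, ne_top_of_le_ne_top h (polyNorm_mono hle f)⟩

/-- If every monomial of `f` involves a variable from `s`, then shrinking the radii of the
variables in `s` by the factor `t` shrinks the norm at least by `t`. -/
theorem polyNorm_le_of_forall_exists {ρ σ : Fin n → ℝ≥0} {t : ℝ≥0} (ht : t ≤ 1)
    {s : Finset (Fin n)} (hs : ∀ i ∈ s, σ i = t * ρ i) (hsc : ∀ i ∉ s, σ i = ρ i)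
    {f : MvPowerSeries (Fin n) 𝕜} (hf : ∀ ν, coeff ν f ≠ 0 → ∃ i ∈ s, ν i ≠ 0) :
    polyNorm σ f ≤ t * polyNorm ρ f := by
  rw [polyNorm, polyNorm, ← ENNReal.tsum_mul_left]
  refine ENNReal.tsum_le_tsum fun ν => ?_
  by_cases h0 : coeff ν f = 0
  · simp [h0]
  obtain ⟨j, hj, hj0⟩ := hf ν h0
  have hle : ∏ i, σ i ^ ν i ≤ t * ∏ i, ρ i ^ ν i := by
    rw [← Finset.mul_prod_erase _ _ (Finset.mem_univ j),
      ← Finset.mul_prod_erase _ (fun i => ρ i ^ ν i) (Finset.mem_univ j), ← mul_assoc]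
    refine mul_le_mul' ?_ (Finset.prod_le_prod' fun i _ => ?_)
    · rw [hs j hj, mul_pow]
      exact mul_le_mul_left (pow_le_of_le_one zero_le ht hj0) _
    · by_cases hi : i ∈ s
      · rw [hs i hi]
        exact pow_le_pow_left₀ zero_le (mul_le_of_le_one_left zero_le ht) _
      · rw [hsc i hi]
  calc _ ≤ ‖coeff ν f‖ₑ * ((t * ∏ i, ρ i ^ ν i : ℝ≥0) : ℝ≥0∞) := by gcongr
    _ = _ := by rw [ENNReal.coe_mul]; ring

/-- Interchange of two sums in `[0, ∞]`. No summability is assumed: if the norms of some coefficient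
sum to `∞`, the bound on it is empty. -/
theorem polyNorm_tsum_le [CompleteSpace 𝕜] (ρ : Fin n → ℝ≥0)
    (f : ℕ → MvPowerSeries (Fin n) 𝕜) :
    polyNorm ρ (fun ν => ∑' k, coeff ν (f k)) ≤ ∑' k, polyNorm ρ (f k) := by
  simp only [polyNorm]
  rw [ENNReal.tsum_comm]
  refine ENNReal.tsum_le_tsum fun ν => ?_
  rw [ENNReal.tsum_mul_right]
  gcongr
  exact enorm_tsum_le_tsum_enorm

end MvPowerSeries

/-! ### Neumann series, inverses and substitution -/

namespace MvPowerSeries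

variable {𝕜 : Type*} [NormedField 𝕜] {n : ℕ}

theorem polyNorm_iterate_neg_le {ρ : Fin n → ℝ≥0}
    (S : MvPowerSeries (Fin n) 𝕜 →+ MvPowerSeries (Fin n) 𝕜)
    (hS : ∀ q, polyNorm ρ (S q) ≤ 2⁻¹ * polyNorm ρ q) (p : MvPowerSeries (Fin n) 𝕜) (k : ℕ) :
    polyNorm ρ ((fun q => -S q)^[k] p) ≤ 2⁻¹ ^ k * polyNorm ρ p := by
  induction k with
  | zero => simp
  | succ k ih =>
    rw [Function.iterate_succ_apply', polyNorm_neg, pow_succ', mul_assoc]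
    exact (hS _).trans (mul_le_mul_right ih _)

/-- Neumann series: `1 + S` is surjective if `S` has norm at most `1 / 2`. -/
theorem exists_add_eq_of_polyNorm_le [CompleteSpace 𝕜] {ρ : Fin n → ℝ≥0} (hρ : ∀ i, 0 < ρ i)
    (S : MvPowerSeries (Fin n) 𝕜 →+ MvPowerSeries (Fin n) 𝕜)
    (hS : ∀ q, polyNorm ρ (S q) ≤ 2⁻¹ * polyNorm ρ q) {p : MvPowerSeries (Fin n) 𝕜}
    (hp : polyNorm ρ p ≠ ∞) : ∃ q, polyNorm ρ q ≠ ∞ ∧ q + S q = p := by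
  set u : ℕ → MvPowerSeries (Fin n) 𝕜 := fun k => (fun q => -S q)^[k] p with hu
  have hu_succ : ∀ k, u (k + 1) = -S (u k) := fun k => Function.iterate_succ_apply' _ _ _
  have hle : ∀ k, polyNorm ρ (u k) ≤ 2⁻¹ ^ k * polyNorm ρ p := polyNorm_iterate_neg_le S hS p
  have htail : ∀ K, ∑' k, polyNorm ρ (u (k + K)) ≤ 2⁻¹ ^ K * (2 * polyNorm ρ p) := by
    intro K
    calc ∑' k, polyNorm ρ (u (k + K)) ≤ ∑' k, 2⁻¹ ^ k * (2⁻¹ ^ K * polyNorm ρ p) :=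
          ENNReal.tsum_le_tsum fun k => (hle _).trans (by rw [pow_add, mul_assoc])
      _ = _ := by
          rw [ENNReal.tsum_mul_right, ENNReal.tsum_geometric, ENNReal.one_sub_inv_two, inv_inv]
          ring
  have hfin : ∑' k, polyNorm ρ (u k) ≠ ∞ := by
    have := htail 0
    simp only [add_zero, pow_zero, one_mul] at this
    exact ne_top_of_le_ne_top (ENNReal.mul_ne_top (by simp) hp) this
  have hsum : ∀ ν, Summable fun k => coeff ν (u k) := by
    intro ν
    have hw : ((∏ i, ρ i ^ ν i : ℝ≥0) : ℝ≥0∞) ≠ 0 := by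
      rw [ENNReal.coe_ne_zero]
      exact (Finset.prod_pos fun i _ => pow_pos (hρ i) _).ne'
    have h1 : (∑' k, ‖coeff ν (u k)‖ₑ) * ((∏ i, ρ i ^ ν i : ℝ≥0) : ℝ≥0∞) ≠ ∞ := by
      rw [← ENNReal.tsum_mul_right]
      exact ne_top_of_le_ne_top hfin
        (ENNReal.tsum_le_tsum fun k => enorm_coeff_mul_le_polyNorm ρ (u k) ν)
    have h2 : ∑' k, ‖coeff ν (u k)‖ₑ ≠ ∞ := fun h => h1 (by rw [h, ENNReal.top_mul hw])
    have h3 : Summable fun k => ‖coeff ν (u k)‖₊ := ENNReal.tsum_coe_ne_top_iff_summable.1 h2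
    exact Summable.of_nnnorm h3
  set q : MvPowerSeries (Fin n) 𝕜 := fun ν => ∑' k, coeff ν (u k) with hq
  have hq_tail : ∀ K, q - ∑ k ∈ Finset.range K, u k =
      (fun ν => ∑' k, coeff ν (u (k + K)) : MvPowerSeries (Fin n) 𝕜) := by
    intro K
    ext ν
    rw [map_sub, map_sum, sub_eq_iff_eq_add']
    exact ((hsum ν).sum_add_tsum_nat_add K).symm
  have hdiff : ∀ K, polyNorm ρ (q - ∑ k ∈ Finset.range K, u k) ≤
      2⁻¹ ^ K * (2 * polyNorm ρ p) := fun K => by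
    rw [hq_tail]
    exact (polyNorm_tsum_le ρ fun k => u (k + K)).trans (htail K)
  -- The partial sums telescope under `1 + S`.
  have hpartial : ∀ K, ∑ k ∈ Finset.range K, u k + S (∑ k ∈ Finset.range K, u k) = p - u K := by
    intro K
    induction K with
    | zero => simp [hu]
    | succ K ih =>
      rw [Finset.sum_range_succ, map_add, hu_succ]
      linear_combination ih
  refine ⟨q, ne_top_of_le_ne_top hfin (polyNorm_tsum_le ρ u), ?_⟩
  rw [← sub_eq_zero]
  apply eq_zero_of_polyNorm_eq_zero hρ
  -- `S` is only additive, so it is not moved through the infinite sum. It is applied to a partial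
  -- sum and to the remainder `e`, and the three error terms contribute `2 + 1 + 1 = 4`.
  have hbound : ∀ K : ℕ, polyNorm ρ (q + S q - p) ≤ 2⁻¹ ^ K * (4 * polyNorm ρ p) := by
    intro K
    set e := q - ∑ k ∈ Finset.range K, u k with he
    have h1 : q + S q - p = e + (S e + -u K) := by
      rw [he, map_sub]
      linear_combination hpartial K
    rw [h1]
    calc _ ≤ polyNorm ρ e + (2⁻¹ * polyNorm ρ e + polyNorm ρ (u K)) := by
          refine (polyNorm_add_le _ _ _).trans ?_
          gcongr
          refine (polyNorm_add_le _ _ _).trans ?_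
          rw [polyNorm_neg]
          gcongr
          exact hS e
      _ ≤ 2⁻¹ ^ K * (2 * polyNorm ρ p) +
          (2⁻¹ * (2⁻¹ ^ K * (2 * polyNorm ρ p)) + 2⁻¹ ^ K * polyNorm ρ p) := by
          gcongr
          · exact hdiff K
          · exact hdiff K
          · exact hle K
      _ = _ := by
          have h2 : (2⁻¹ : ℝ≥0∞) * 2 = 1 := ENNReal.inv_mul_cancel (by simp) (by simp)
          calc _ = 2⁻¹ ^ K * polyNorm ρ p * (2 + 2⁻¹ * 2 + 1) := by ring
            _ = _ := by rw [h2]; ring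
  refine le_antisymm (ge_of_tendsto' (f := fun K : ℕ => (2⁻¹ : ℝ≥0∞) ^ K * (4 * polyNorm ρ p))
    (x := Filter.atTop) ?_ hbound) zero_le
  have h4 : 4 * polyNorm ρ p ≠ ∞ := ENNReal.mul_ne_top (by simp) hp
  have := ENNReal.Tendsto.mul_const (b := 4 * polyNorm ρ p)
    (ENNReal.tendsto_pow_atTop_nhds_zero_of_lt_one (r := 2⁻¹) (by simp)) (Or.inr h4)
  simpa using this

/-- Injectivity of `1 + S`: the norm of `q` is at most half of itself, and it is finite. -/
theorem eq_zero_of_add_eq_zero_of_polyNorm_le {ρ : Fin n → ℝ≥0} (hρ : ∀ i, 0 < ρ i)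
    {q s : MvPowerSeries (Fin n) 𝕜} (hs : polyNorm ρ s ≤ 2⁻¹ * polyNorm ρ q)
    (hq : polyNorm ρ q ≠ ∞) (h : q + s = 0) : q = 0 := by
  apply eq_zero_of_polyNorm_eq_zero hρ
  rw [eq_neg_of_add_eq_zero_right h, polyNorm_neg] at hs
  by_contra h0
  have h1 : (2⁻¹ : ℝ≥0∞) * polyNorm ρ q < polyNorm ρ q := by
    simpa [ENNReal.div_eq_inv_mul] using ENNReal.half_lt_self h0 hq
  exact absurd hs (not_le.2 h1)

/-- Every monomial present has positive degree, so scaling all radii by `t ≤ 1` scales the norm by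
at most `t`. -/
theorem exists_polyNorm_le_of_constantCoeff_eq_zero {f : MvPowerSeries (Fin n) 𝕜}
    (hf : IsConvergentSeries f) (h0 : constantCoeff f = 0) {ε : ℝ≥0} (hε : 0 < ε) :
    ∃ r : ℝ≥0, 0 < r ∧ ∀ s ≤ r, polyNorm (fun _ => s) f ≤ ε := by
  obtain ⟨r, hr, hfin⟩ := isConvergentSeries_iff.1 hf
  lift polyNorm (fun _ => r) f to ℝ≥0 using hfin with M hM
  have ht : 0 < min 1 (ε / (M + 1)) := lt_min one_pos (by positivity)
  refine ⟨min 1 (ε / (M + 1)) * r, by positivity, fun s hs => ?_⟩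
  refine (polyNorm_mono (fun _ => hs) f).trans ?_
  refine (polyNorm_le_of_forall_exists (ρ := fun _ => r) (t := min 1 (ε / (M + 1)))
    (min_le_left _ _) (s := Finset.univ)
    (by simp) (by simp) fun ν hν => ?_).trans ?_
  · by_contra! hc
    have : ν = 0 := by ext i; simpa using hc i
    subst this
    exact hν h0
  · rw [← hM]
    norm_cast
    calc min 1 (ε / (M + 1)) * M ≤ ε / (M + 1) * (M + 1) := by
          gcongr
          · exact min_le_right _ _
          · exact le_self_add
      _ = ε := by field_simp

theorem exists_one_add_mul_eq_one [CompleteSpace 𝕜]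
    {a : MvPowerSeries (Fin n) 𝕜} (ha : IsConvergentSeries a) (h0 : constantCoeff a = 0) :
    ∃ q, IsConvergentSeries q ∧ (1 + a) * q = 1 := by
  obtain ⟨r, hr, hle⟩ := exists_polyNorm_le_of_constantCoeff_eq_zero ha h0 (ε := 2⁻¹) (by simp)
  have hS : ∀ q, polyNorm (fun _ => r) (AddMonoidHom.mulLeft a q) ≤
      2⁻¹ * polyNorm (fun _ => r) q := fun q => by
    refine (polyNorm_mul_le _ _ _).trans ?_
    gcongr
    simpa using hle r le_rfl
  have h1 : polyNorm (fun _ => r) (1 : MvPowerSeries (Fin n) 𝕜) ≠ ∞ := by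
    rw [← map_one C, polyNorm_C]
    simp
  obtain ⟨q, hq, h⟩ := exists_add_eq_of_polyNorm_le (fun _ => hr) _ hS h1
  exact ⟨q, isConvergentSeries_of_polyNorm (fun _ => hr) hq, by rw [add_mul, one_mul]; exact h⟩

theorem enorm_finsum_le_tsum {ι : Type*} {f : ι → 𝕜} (hf : (Function.support f).Finite) :
    ‖∑ᶠ i, f i‖ₑ ≤ ∑' i, ‖f i‖ₑ := by
  rw [finsum_eq_sum f hf]
  exact (enorm_sum_le _ _).trans (ENNReal.sum_le_tsum _)

/-- Expand the substituted series monomial by monomial, interchange the sums, and use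
submultiplicativity on each product of powers of the `a i`. -/
theorem polyNorm_subst_le {m : ℕ} {a : Fin m → MvPowerSeries (Fin n) 𝕜} (ha : HasSubst a)
    {ρ : Fin n → ℝ≥0} {σ : Fin m → ℝ≥0} (h : ∀ i, polyNorm ρ (a i) ≤ σ i)
    (f : MvPowerSeries (Fin m) 𝕜) : polyNorm ρ (subst a f) ≤ polyNorm σ f := by
  calc polyNorm ρ (subst a f)
      ≤ ∑' e : Fin n →₀ ℕ, ∑' d : Fin m →₀ ℕ,
        ‖coeff d f‖ₑ * (‖coeff e (d.prod fun s k => a s ^ k)‖ₑ *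
          ((∏ i, ρ i ^ e i : ℝ≥0) : ℝ≥0∞)) := by
        refine ENNReal.tsum_le_tsum fun e => ?_
        rw [coeff_subst ha]
        refine (mul_le_mul_left (enorm_finsum_le_tsum (coeff_subst_finite ha f e)) _).trans ?_
        rw [← ENNReal.tsum_mul_right]
        refine ENNReal.tsum_le_tsum fun d => ?_
        rw [smul_eq_mul, enorm_mul, mul_assoc]
    _ = ∑' d : Fin m →₀ ℕ, ‖coeff d f‖ₑ * polyNorm ρ (d.prod fun s k => a s ^ k) := by
        rw [ENNReal.tsum_comm]
        simp only [ENNReal.tsum_mul_left, polyNorm]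
    _ ≤ polyNorm σ f := by
        refine ENNReal.tsum_le_tsum fun d => ?_
        gcongr
        rw [Finsupp.prod_fintype _ _ (by simp)]
        refine (polyNorm_prod_le _ _ _).trans ?_
        push_cast
        gcongr with i
        exact (polyNorm_pow_le _ _ _).trans (pow_le_pow_left₀ zero_le (h i) _)

theorem isConvergentSeries_subst {m : ℕ} {a : Fin m → MvPowerSeries (Fin n) 𝕜}
    (ha : ∀ i, IsConvergentSeries (a i)) (ha0 : ∀ i, constantCoeff (a i) = 0)
    {f : MvPowerSeries (Fin m) 𝕜} (hf : IsConvergentSeries f) :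
    IsConvergentSeries (subst a f) := by
  obtain ⟨s, hs, hfin⟩ := isConvergentSeries_iff.1 hf
  choose r hr hle using fun i => exists_polyNorm_le_of_constantCoeff_eq_zero (ha i) (ha0 i) hs
  have : ∃ t : ℝ≥0, 0 < t ∧ ∀ i, t ≤ r i := by
    rcases isEmpty_or_nonempty (Fin m) with he | he
    · exact ⟨1, one_pos, fun i => he.elim i⟩
    · obtain ⟨i, hi⟩ := Finite.exists_min r
      exact ⟨r i, hr i, hi⟩
  obtain ⟨t, ht, htr⟩ := this
  refine isConvergentSeries_of_polyNorm (ρ := fun _ => t) (fun _ => ht) (ne_top_of_le_ne_top hfin ?_)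
  exact polyNorm_subst_le (hasSubst_of_constantCoeff_zero ha0) (fun i => hle i t (htr i)) f

theorem isConvergentSeries_X (i : Fin n) : IsConvergentSeries (X i : MvPowerSeries (Fin n) 𝕜) :=
  isConvergentSeries_of_polyNorm (ρ := fun _ => 1) (fun _ => one_pos) (by simp [polyNorm_X])

end MvPowerSeries

/-! ### Units, substitution, and polynomials in `x₀` -/

namespace ConvergentSeries

variable {𝕜 : Type*} [NormedField 𝕜] {n : ℕ}

theorem isUnit_iff [CompleteSpace 𝕜] {a : ConvergentSeries 𝕜 n} :
    IsUnit a ↔ MvPowerSeries.constantCoeff a.1 ≠ 0 := by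
  constructor
  · intro h
    exact (h.map ((MvPowerSeries.constantCoeff (σ := Fin n) (R := 𝕜)).comp
      (ConvergentSeries 𝕜 n).val.toRingHom)).ne_zero
  · intro h
    set c := MvPowerSeries.constantCoeff a.1 with hc
    set b : ConvergentSeries 𝕜 n := c⁻¹ • a - 1 with hb
    have hb0 : MvPowerSeries.constantCoeff b.1 = 0 := by
      simp only [hb, AddSubgroupClass.coe_sub, SetLike.val_smul, OneMemClass.coe_one, map_sub,
        map_one]
      rw [MvPowerSeries.constantCoeff_smul, ← hc, smul_eq_mul, inv_mul_cancel₀ h, sub_self]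
    obtain ⟨q, hq, hbq⟩ := MvPowerSeries.exists_one_add_mul_eq_one b.2 hb0
    have h1 : (1 + b) * ⟨q, hq⟩ = 1 := Subtype.ext hbq
    rw [hb, add_sub_cancel, smul_mul_assoc, ← mul_smul_comm] at h1
    exact IsUnit.of_mul_eq_one _ h1

/-- The partial derivative `∂/∂xᵢ` as a derivation of `𝕜{x}`. -/
noncomputable def pderivDerivation (i : Fin n) :
    Derivation 𝕜 (ConvergentSeries 𝕜 n) (ConvergentSeries 𝕜 n) where
  toFun := pderiv i
  map_add' a b := Subtype.ext (map_add (MvPowerSeries.pderiv 𝕜 i) a.1 b.1)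
  map_smul' c a := Subtype.ext ((MvPowerSeries.pderiv 𝕜 i).map_smul c a.1)
  map_one_eq_zero' := Subtype.ext (MvPowerSeries.pderiv 𝕜 i).map_one_eq_zero
  leibniz' a b := Subtype.ext ((MvPowerSeries.pderiv 𝕜 i).leibniz a.1 b.1)

@[simp]
theorem pderivDerivation_apply (i : Fin n) (a : ConvergentSeries 𝕜 n) :
    pderivDerivation i a = pderiv i a := rfl

theorem pderiv_mul (i : Fin n) (a b : ConvergentSeries 𝕜 n) :
    pderiv i (a * b) = a * pderiv i b + b * pderiv i a :=
  (pderivDerivation i).leibniz a b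

/-- The coordinate function `xᵢ` as an element of `𝕜{x}`. -/
noncomputable def X (i : Fin n) : ConvergentSeries 𝕜 n :=
  ⟨MvPowerSeries.X i, MvPowerSeries.isConvergentSeries_X i⟩

/-- Evaluation at the origin. -/
noncomputable def evalZero : ConvergentSeries 𝕜 n →+* 𝕜 :=
  MvPowerSeries.constantCoeff.comp (ConvergentSeries 𝕜 n).val.toRingHom

theorem evalZero_apply (a : ConvergentSeries 𝕜 n) :
    evalZero a = MvPowerSeries.constantCoeff a.1 := rfl

theorem evalZero_X (i : Fin n) : evalZero (X i : ConvergentSeries 𝕜 n) = 0 :=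
  MvPowerSeries.constantCoeff_X i

theorem evalZero_smul (c : 𝕜) (a : ConvergentSeries 𝕜 n) : evalZero (c • a) = c * evalZero a :=
  MvPowerSeries.constantCoeff_smul a.1 c

theorem hasSubst_coe {m : ℕ} {a : Fin m → ConvergentSeries 𝕜 n} (ha : ∀ i, evalZero (a i) = 0) :
    MvPowerSeries.HasSubst fun i => (a i).1 :=
  MvPowerSeries.hasSubst_of_constantCoeff_zero ha

/-- Substitution of convergent series without constant term. -/
noncomputable def substHom {m : ℕ} (a : Fin m → ConvergentSeries 𝕜 n)
    (ha : ∀ i, evalZero (a i) = 0) :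
    ConvergentSeries 𝕜 m →ₐ[𝕜] ConvergentSeries 𝕜 n :=
  ((MvPowerSeries.substAlgHom (hasSubst_coe ha)).comp
    (ConvergentSeries 𝕜 m).val).codRestrict (ConvergentSeries 𝕜 n) fun f => by
      rw [AlgHom.comp_apply, MvPowerSeries.substAlgHom_apply]
      exact MvPowerSeries.isConvergentSeries_subst (fun i => (a i).2) ha f.2

theorem coe_substHom {m : ℕ} (a : Fin m → ConvergentSeries 𝕜 n)
    (ha : ∀ i, evalZero (a i) = 0) (f : ConvergentSeries 𝕜 m) :
    (substHom a ha f).1 = MvPowerSeries.subst (fun i => (a i).1) f.1 :=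
  MvPowerSeries.substAlgHom_apply (hasSubst_coe ha) f.1

theorem substHom_X {m : ℕ} (a : Fin m → ConvergentSeries 𝕜 n)
    (ha : ∀ i, evalZero (a i) = 0) (i : Fin m) :
    substHom a ha (X i) = a i := by
  refine Subtype.ext ?_
  rw [coe_substHom]
  exact MvPowerSeries.subst_X (hasSubst_coe ha) i

/-- The inclusion `𝕜{x₁, …, xₙ} → 𝕜{x₀, …, xₙ}`. -/
noncomputable def liftSucc : ConvergentSeries 𝕜 n →ₐ[𝕜] ConvergentSeries 𝕜 (n + 1) :=
  substHom (fun i => X i.succ) fun i => evalZero_X i.succ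

theorem coe_liftSucc (a : ConvergentSeries 𝕜 n) :
    (liftSucc a).1 = MvPowerSeries.rename (Fin.succEmb n) a.1 := by
  rw [liftSucc, coe_substHom, MvPowerSeries.rename_eq_subst]
  rfl

theorem finSuccEquiv_liftSucc (a : ConvergentSeries 𝕜 n) :
    MvPowerSeries.finSuccEquiv 𝕜 n (liftSucc a).1 = PowerSeries.C a.1 := by
  ext k x
  rw [MvPowerSeries.coeff_coeff_finSuccEquiv, coe_liftSucc, PowerSeries.coeff_C]
  split_ifs with hk
  · subst hk
    rw [← MvPowerSeries.coeff_embDomain_rename (Fin.succEmb n) a.1 x]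
    congr 1
    congr 1
    ext i
    refine Fin.cases ?_ (fun j => ?_) i
    · rw [Finsupp.cons_zero, Finsupp.embDomain_of_notMem_range]
      simp
    · rw [Finsupp.cons_succ]
      exact (Finsupp.embDomain_apply_self (Fin.succEmb n) x j).symm
  · rw [MvPowerSeries.coeff_rename_eq_zero]
    · simp
    · rintro ⟨y, hy⟩
      apply hk
      have := congrArg (fun z => z 0) hy
      simp only [Finsupp.cons_zero] at this
      rw [← this, Finsupp.mapDomain_of_notMem_range]
      simp

/-- A polynomial in `x₀` over `𝕜{x₁, …, xₙ}`, viewed as an element of `𝕜{x₀, …, xₙ}`. -/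
noncomputable def ofPoly :
    Polynomial (ConvergentSeries 𝕜 n) →+* ConvergentSeries 𝕜 (n + 1) :=
  Polynomial.eval₂RingHom (liftSucc : ConvergentSeries 𝕜 n →ₐ[𝕜] _).toRingHom (X 0)

@[simp]
theorem ofPoly_C (a : ConvergentSeries 𝕜 n) : ofPoly (Polynomial.C a) = liftSucc a := by
  simp [ofPoly]

@[simp]
theorem ofPoly_X : ofPoly (Polynomial.X : Polynomial (ConvergentSeries 𝕜 n)) = X 0 := by
  simp [ofPoly]

theorem finSuccEquiv_ofPoly (P : Polynomial (ConvergentSeries 𝕜 n)) :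
    MvPowerSeries.finSuccEquiv 𝕜 n (ofPoly P).1 =
      (P.map (ConvergentSeries 𝕜 n).val.toRingHom : PowerSeries (MvPowerSeries (Fin n) 𝕜)) := by
  have h : ((MvPowerSeries.finSuccEquiv 𝕜 n).toRingEquiv.toRingHom.comp
      (ConvergentSeries 𝕜 (n + 1)).val.toRingHom).comp ofPoly =
      Polynomial.coeToPowerSeries.ringHom.comp
        (Polynomial.mapRingHom (ConvergentSeries 𝕜 n).val.toRingHom) := by
    refine Polynomial.ringHom_ext (fun a => ?_) ?_
    · have := finSuccEquiv_liftSucc a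
      simpa using this
    · have : MvPowerSeries.finSuccEquiv 𝕜 n (X 0).1 = PowerSeries.X :=
        MvPowerSeries.finSuccEquiv_X_zero
      simpa using this
  exact DFunLike.congr_fun h P

/-- The dictionary between `𝕜{x₁, …, xₙ}[x₀]` and `𝕜{x₀, …, xₙ}` through which later coefficient
computations pass. -/
theorem coeff_cons_ofPoly (P : Polynomial (ConvergentSeries 𝕜 n)) (k : ℕ) (x : Fin n →₀ ℕ) :
    MvPowerSeries.coeff (x.cons k) (ofPoly P).1 = MvPowerSeries.coeff x (P.coeff k).1 := by
  rw [← MvPowerSeries.coeff_coeff_finSuccEquiv, finSuccEquiv_ofPoly]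
  simp

theorem ofPoly_injective :
    Function.Injective (ofPoly : Polynomial (ConvergentSeries 𝕜 n) →+* _) := by
  intro P Q h
  ext k : 1
  refine Subtype.ext (MvPowerSeries.ext fun x => ?_)
  rw [← coeff_cons_ofPoly, ← coeff_cons_ofPoly, h]

end ConvergentSeries

/-! ### Estimates for division by a perturbation of `x₀ ^ d` -/

namespace MvPowerSeries

variable {𝕜 : Type*} [NormedField 𝕜] {n : ℕ}

/-- The quotient of the division of a power series by `x₀ ^ d`. -/
noncomputable def shift (d : ℕ) :
    MvPowerSeries (Fin (n + 1)) 𝕜 →ₗ[𝕜] MvPowerSeries (Fin (n + 1)) 𝕜 where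
  toFun f := fun ν => coeff (ν + Finsupp.single 0 d) f
  map_add' _ _ := rfl
  map_smul' _ _ := rfl

theorem coeff_shift (d : ℕ) (f : MvPowerSeries (Fin (n + 1)) 𝕜) (ν : Fin (n + 1) →₀ ℕ) :
    coeff ν (shift d f) = coeff (ν + Finsupp.single 0 d) f := rfl

theorem shift_X_pow_mul (d : ℕ) (f : MvPowerSeries (Fin (n + 1)) 𝕜) :
    shift d (X 0 ^ d * f) = f := by
  ext ν
  rw [coeff_shift, X_pow_eq, add_comm ν, coeff_add_monomial_mul, one_mul]

theorem coeff_sub_X_pow_mul_shift (d : ℕ) (f : MvPowerSeries (Fin (n + 1)) 𝕜)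
    {ν : Fin (n + 1) →₀ ℕ} (hν : ν 0 < d) : coeff ν (f - X 0 ^ d * shift d f) = coeff ν f := by
  classical
  rw [map_sub, X_pow_eq, coeff_monomial_mul, if_neg, sub_zero]
  intro h
  have := h 0
  simp at this
  omega

theorem coeff_sub_X_pow_mul_shift_of_le (d : ℕ) (f : MvPowerSeries (Fin (n + 1)) 𝕜)
    {ν : Fin (n + 1) →₀ ℕ} (hν : d ≤ ν 0) : coeff ν (f - X 0 ^ d * shift d f) = 0 := by
  have h : ν = (ν - Finsupp.single 0 d) + Finsupp.single 0 d := by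
    rw [tsub_add_cancel_of_le]
    simpa using hν
  rw [h, ← coeff_shift, map_sub, shift_X_pow_mul, sub_self, map_zero]

theorem polyNorm_shift_mul_le (ρ : Fin (n + 1) → ℝ≥0) (d : ℕ)
    (f : MvPowerSeries (Fin (n + 1)) 𝕜) :
    (ρ 0 : ℝ≥0∞) ^ d * polyNorm ρ (shift d f) ≤ polyNorm ρ f := by
  have hinj : Function.Injective fun ν : Fin (n + 1) →₀ ℕ => ν + Finsupp.single 0 d :=
    add_left_injective _
  refine le_trans (le_of_eq ?_) (ENNReal.tsum_comp_le_tsum_of_injective hinj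
    (fun ν => ‖coeff ν f‖ₑ * ((∏ i, ρ i ^ ν i : ℝ≥0) : ℝ≥0∞)))
  rw [polyNorm, ← ENNReal.tsum_mul_left]
  refine tsum_congr fun ν => ?_
  rw [coeff_shift]
  simp only [Finsupp.add_apply, pow_add, Finset.prod_mul_distrib, ENNReal.coe_mul]
  have : ∏ i, ρ i ^ (Finsupp.single (0 : Fin (n + 1)) d) i = ρ 0 ^ d := by
    rw [Finset.prod_eq_single 0]
    · simp
    · intro j _ hj
      simp [Finsupp.single_eq_of_ne hj]
    · simp
  rw [this, ENNReal.coe_pow]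
  ring

theorem polyNorm_coeff_finSuccEquiv_mul_le (ρ : Fin (n + 1) → ℝ≥0) (k : ℕ)
    (f : MvPowerSeries (Fin (n + 1)) 𝕜) :
    (ρ 0 : ℝ≥0∞) ^ k * polyNorm (fun i => ρ i.succ) (PowerSeries.coeff k (finSuccEquiv 𝕜 n f)) ≤
      polyNorm ρ f := by
  have hinj : Function.Injective fun x : Fin n →₀ ℕ => x.cons k :=
    Finsupp.cons_right_injective k
  refine le_trans (le_of_eq ?_) (ENNReal.tsum_comp_le_tsum_of_injective hinj
    (fun ν => ‖coeff ν f‖ₑ * ((∏ i, ρ i ^ ν i : ℝ≥0) : ℝ≥0∞)))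
  rw [polyNorm, ← ENNReal.tsum_mul_left]
  refine tsum_congr fun x => ?_
  rw [coeff_coeff_finSuccEquiv, Fin.prod_univ_succ]
  simp only [Finsupp.cons_zero, Finsupp.cons_succ, ENNReal.coe_mul, ENNReal.coe_pow]
  ring

theorem isConvergentSeries_shift {f : MvPowerSeries (Fin (n + 1)) 𝕜} (hf : IsConvergentSeries f)
    (d : ℕ) : IsConvergentSeries (shift d f) := by
  obtain ⟨r, hr, hfin⟩ := isConvergentSeries_iff.1 hf
  refine isConvergentSeries_of_polyNorm (ρ := fun _ => r) (fun _ => hr) fun h => hfin ?_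
  have := polyNorm_shift_mul_le (fun _ => r) d f
  rwa [h, ENNReal.mul_top (by simp [hr.ne']), top_le_iff] at this

theorem isConvergentSeries_coeff_finSuccEquiv {f : MvPowerSeries (Fin (n + 1)) 𝕜}
    (hf : IsConvergentSeries f) (k : ℕ) :
    IsConvergentSeries (PowerSeries.coeff k (finSuccEquiv 𝕜 n f)) := by
  obtain ⟨r, hr, hfin⟩ := isConvergentSeries_iff.1 hf
  refine isConvergentSeries_of_polyNorm (ρ := fun _ => r) (fun _ => hr) fun h => hfin ?_
  have := polyNorm_coeff_finSuccEquiv_mul_le (fun _ => r) k f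
  rwa [h, ENNReal.mul_top (by simp [hr.ne']), top_le_iff] at this

/-- If `w` vanishes on the `x₀`-axis, there are polyradii on which `f` is finite and
`w` is small compared with `x₀ ^ d`. -/
theorem exists_polyradius {w f : MvPowerSeries (Fin (n + 1)) 𝕜} (hw : IsConvergentSeries w)
    (hf : IsConvergentSeries f) (hw0 : ∀ k, coeff (Finsupp.single 0 k) w = 0) (d : ℕ) :
    ∃ ρ : Fin (n + 1) → ℝ≥0, (∀ i, 0 < ρ i) ∧ polyNorm ρ f ≠ ∞ ∧
      polyNorm ρ w ≤ 2⁻¹ * (ρ 0 : ℝ≥0∞) ^ d := by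
  obtain ⟨r, hr, hwr⟩ := isConvergentSeries_iff.1 hw
  obtain ⟨s, hs, hfs⟩ := isConvergentSeries_iff.1 hf
  set a := min r s
  have ha : 0 < a := lt_min hr hs
  have hwa : polyNorm (fun _ => a) w ≠ ∞ :=
    ne_top_of_le_ne_top hwr (polyNorm_mono (fun _ => min_le_left r s) w)
  have hfa : polyNorm (fun _ => a) f ≠ ∞ :=
    ne_top_of_le_ne_top hfs (polyNorm_mono (fun _ => min_le_right r s) f)
  lift polyNorm (fun _ => a) w to ℝ≥0 using hwa with M hM
  -- The radius of `x₀` stays `a`, the others shrink by `t`. Every monomial of `w` contains one of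
  -- the shrunk variables, so `t * M ≤ a ^ d / 2` suffices; `M + 1` avoids division by zero.
  set t : ℝ≥0 := min 1 (2⁻¹ * a ^ d / (M + 1)) with ht
  have ht0 : 0 < t := lt_min one_pos (by positivity)
  have ht1 : t ≤ 1 := min_le_left _ _
  refine ⟨fun i => if i = 0 then a else t * a, fun i => ?_, ?_, ?_⟩
  · dsimp only
    split_ifs <;> positivity
  · refine ne_top_of_le_ne_top hfa (polyNorm_mono (fun i => ?_) f)
    dsimp only
    split_ifs
    · exact le_rfl
    · exact mul_le_of_le_one_left zero_le ht1
  · refine (polyNorm_le_of_forall_exists (ρ := fun _ => a) ht1 (s := Finset.univ.erase 0)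
      (fun i hi => ?_) (fun i hi => ?_) fun ν hν => ?_).trans ?_
    · rw [if_neg (Finset.ne_of_mem_erase hi)]
    · have : i = 0 := by simpa using hi
      rw [if_pos this]
    · by_contra! hc
      refine hν ?_
      have : ν = Finsupp.single 0 (ν 0) := by
        ext i
        by_cases hi : i = 0
        · simp [hi]
        · rw [hc i (by simp [hi]), Finsupp.single_eq_of_ne hi]
      rw [this]
      exact hw0 _
    · rw [← hM]
      simp only [if_true]
      have : t * M ≤ 2⁻¹ * a ^ d := by
        calc t * M ≤ 2⁻¹ * a ^ d / (M + 1) * (M + 1) := by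
              gcongr
              · exact min_le_right _ _
              · exact le_self_add
          _ = 2⁻¹ * a ^ d := by field_simp
      calc (t : ℝ≥0∞) * M = ((t * M : ℝ≥0) : ℝ≥0∞) := by push_cast; rfl
        _ ≤ ((2⁻¹ * a ^ d : ℝ≥0) : ℝ≥0∞) := by exact_mod_cast this
        _ = _ := by push_cast; simp

theorem polyNorm_shift_mul_le_half {ρ : Fin (n + 1) → ℝ≥0} (hρ : ∀ i, 0 < ρ i) {d : ℕ}
    {w : MvPowerSeries (Fin (n + 1)) 𝕜} (hw : polyNorm ρ w ≤ 2⁻¹ * (ρ 0 : ℝ≥0∞) ^ d)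
    (q : MvPowerSeries (Fin (n + 1)) 𝕜) :
    polyNorm ρ (shift d (w * q)) ≤ 2⁻¹ * polyNorm ρ q := by
  have h0 : (ρ 0 : ℝ≥0∞) ^ d ≠ 0 := by simp [(hρ 0).ne']
  have h1 : (ρ 0 : ℝ≥0∞) ^ d ≠ ∞ := by simp
  rw [← ENNReal.mul_le_mul_iff_right h0 h1]
  calc _ ≤ polyNorm ρ (w * q) := polyNorm_shift_mul_le ρ d _
    _ ≤ polyNorm ρ w * polyNorm ρ q := polyNorm_mul_le _ _ _
    _ ≤ 2⁻¹ * (ρ 0 : ℝ≥0∞) ^ d * polyNorm ρ q := by gcongr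
    _ = _ := by ring

/-- A remainder of degree `< d` in `x₀` is one killed by `shift d`. Applied to `f = q (x₀ ^ d + w) +
r`, this reads `q + shift d (w q) = shift d f`, an equation `(1 + S) q = p` with `S` of norm at most
`1 / 2`. -/
theorem exists_shift_eq_shift_mul [CompleteSpace 𝕜] {w f : MvPowerSeries (Fin (n + 1)) 𝕜}
    (hw : IsConvergentSeries w) (hf : IsConvergentSeries f)
    (hw0 : ∀ k, coeff (Finsupp.single 0 k) w = 0) (d : ℕ) :
    ∃ q, IsConvergentSeries q ∧ shift d (f - q * (X 0 ^ d + w)) = 0 := by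
  obtain ⟨ρ, hρ, hfin, hle⟩ := exists_polyradius hw (isConvergentSeries_shift hf d) hw0 d
  obtain ⟨q, hq, h⟩ := exists_add_eq_of_polyNorm_le hρ
    ((shift d).toAddMonoidHom.comp (AddMonoidHom.mulLeft w))
    (fun q => polyNorm_shift_mul_le_half hρ hle q) hfin
  refine ⟨q, isConvergentSeries_of_polyNorm hρ hq, ?_⟩
  have h' : q + shift d (w * q) = shift d f := h
  rw [map_sub, mul_add, map_add, mul_comm q, shift_X_pow_mul, mul_comm q, h', sub_self]

theorem eq_zero_of_shift_mul_eq_zero {w q : MvPowerSeries (Fin (n + 1)) 𝕜}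
    (hw : IsConvergentSeries w) (hq : IsConvergentSeries q)
    (hw0 : ∀ k, coeff (Finsupp.single 0 k) w = 0) {d : ℕ}
    (h : shift d (q * (X 0 ^ d + w)) = 0) : q = 0 := by
  obtain ⟨ρ, hρ, hfin, hle⟩ := exists_polyradius hw hq hw0 d
  refine eq_zero_of_add_eq_zero_of_polyNorm_le hρ (polyNorm_shift_mul_le_half hρ hle q) hfin ?_
  rwa [mul_add, map_add, mul_comm q, shift_X_pow_mul, mul_comm q] at h

end MvPowerSeries

/-! ### Weierstrass division -/

namespace ConvergentSeries

variable {𝕜 : Type*} [NormedField 𝕜] {n : ℕ}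

/-- The restriction of `g` to the `x₀`-axis vanishes exactly to order `d`. -/
def IsRegularOfOrder (d : ℕ) (g : ConvergentSeries 𝕜 (n + 1)) : Prop :=
  (∀ k < d, MvPowerSeries.coeff (Finsupp.single 0 k) g.1 = 0) ∧
    MvPowerSeries.coeff (Finsupp.single 0 d) g.1 ≠ 0

theorem exists_ofPoly_eq {d : ℕ} {f : ConvergentSeries 𝕜 (n + 1)}
    (hf : MvPowerSeries.shift d f.1 = 0) :
    ∃ P : Polynomial (ConvergentSeries 𝕜 n), P.degree < d ∧ ofPoly P = f := by
  set c : ℕ → ConvergentSeries 𝕜 n := fun k =>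
    ⟨_, MvPowerSeries.isConvergentSeries_coeff_finSuccEquiv f.2 k⟩ with hc
  refine ⟨∑ k ∈ Finset.range d, Polynomial.monomial k (c k), ?_, ?_⟩
  · refine (Polynomial.degree_sum_le _ _).trans_lt ?_
    rw [Finset.sup_lt_iff (by exact WithBot.bot_lt_coe d)]
    intro k hk
    exact (Polynomial.degree_monomial_le _ _).trans_lt (by exact_mod_cast Finset.mem_range.1 hk)
  · refine Subtype.ext (MvPowerSeries.ext fun ν => ?_)
    rw [← Finsupp.cons_tail ν, coeff_cons_ofPoly, Polynomial.finsetSum_coeff]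
    simp only [Polynomial.coeff_monomial, Finset.sum_ite_eq', Finset.mem_range]
    split_ifs with h
    · exact MvPowerSeries.coeff_coeff_finSuccEquiv f.1
    · have : Finsupp.cons (ν 0) ν.tail = (ν - Finsupp.single 0 d) + Finsupp.single 0 d := by
        rw [Finsupp.cons_tail, tsub_add_cancel_of_le]
        simpa using h
      rw [this, ← MvPowerSeries.coeff_shift, hf]
      simp

theorem shift_ofPoly_eq_zero {d : ℕ} {P : Polynomial (ConvergentSeries 𝕜 n)}
    (hP : P.degree < d) : MvPowerSeries.shift d (ofPoly P).1 = 0 := by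
  ext ν
  rw [MvPowerSeries.coeff_shift, ← Finsupp.cons_tail (ν + Finsupp.single 0 d), coeff_cons_ofPoly,
    Polynomial.coeff_eq_zero_of_degree_lt]
  · simp
  · refine hP.trans_le ?_
    rw [Finsupp.add_apply, Finsupp.single_eq_same]
    exact_mod_cast Nat.le_add_left d (ν 0)

/-- A regular series is a unit times a perturbation of `x₀ ^ d` that vanishes on the
`x₀`-axis. -/
theorem IsRegularOfOrder.exists_unit_mul_eq [CompleteSpace 𝕜] {d : ℕ}
    {g : ConvergentSeries 𝕜 (n + 1)} (hg : IsRegularOfOrder d g) :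
    ∃ (u : (ConvergentSeries 𝕜 (n + 1))ˣ) (w : ConvergentSeries 𝕜 (n + 1)),
      (∀ k, MvPowerSeries.coeff (Finsupp.single 0 k) w.1 = 0) ∧
      (u : ConvergentSeries 𝕜 (n + 1)) * g = X 0 ^ d + w := by
  classical
  set s : ConvergentSeries 𝕜 (n + 1) :=
    ⟨_, MvPowerSeries.isConvergentSeries_shift g.2 d⟩ with hs
  have hsu : IsUnit s := isUnit_iff.2 (by
    rw [← MvPowerSeries.coeff_zero_eq_constantCoeff_apply]
    simpa [hs, MvPowerSeries.coeff_shift] using hg.2)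
  obtain ⟨u, hu⟩ := hsu
  refine ⟨u⁻¹, (↑u⁻¹ : ConvergentSeries 𝕜 (n + 1)) * (g - X 0 ^ d * s), fun k => ?_, ?_⟩
  · have hcoe : ((↑u⁻¹ : ConvergentSeries 𝕜 (n + 1)) * (g - X 0 ^ d * s)).1 =
      (↑u⁻¹ : ConvergentSeries 𝕜 (n + 1)).1 *
        (g.1 - MvPowerSeries.X 0 ^ d * MvPowerSeries.shift d g.1) := rfl
    rw [hcoe, MvPowerSeries.coeff_mul]
    refine Finset.sum_eq_zero fun p hp => ?_
    rw [Finset.HasAntidiagonal.mem_antidiagonal] at hp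
    -- A summand of an exponent on the `x₀`-axis lies on that axis, so only axis coefficients of the
    -- second factor enter.
    have hp2 : p.2 = Finsupp.single 0 (p.2 0) := by
      ext i
      by_cases hi : i = 0
      · simp [hi]
      · have := DFunLike.congr_fun hp i
        rw [Finsupp.add_apply, Finsupp.single_eq_of_ne hi] at this
        rw [Finsupp.single_eq_of_ne hi]
        omega
    rcases lt_or_ge (p.2 0) d with h | h
    · rw [MvPowerSeries.coeff_sub_X_pow_mul_shift d _ h, hp2, hg.1 _ h, mul_zero]
    · rw [MvPowerSeries.coeff_sub_X_pow_mul_shift_of_le d _ h, mul_zero]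
  · rw [← hu]
    have : (↑u⁻¹ : ConvergentSeries 𝕜 (n + 1)) * u = 1 := u.inv_mul
    linear_combination (X 0 : ConvergentSeries 𝕜 (n + 1)) ^ d * this

/-- Weierstrass division. -/
theorem IsRegularOfOrder.exists_eq_mul_add [CompleteSpace 𝕜] {d : ℕ}
    {g : ConvergentSeries 𝕜 (n + 1)} (hg : IsRegularOfOrder d g)
    (f : ConvergentSeries 𝕜 (n + 1)) :
    ∃ (q : ConvergentSeries 𝕜 (n + 1)) (P : Polynomial (ConvergentSeries 𝕜 n)),
      P.degree < d ∧ f = q * g + ofPoly P := by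
  obtain ⟨u, w, hw0, hu⟩ := hg.exists_unit_mul_eq
  obtain ⟨q, hq, h⟩ := MvPowerSeries.exists_shift_eq_shift_mul w.2 f.2 hw0 d
  obtain ⟨P, hP, hPe⟩ := exists_ofPoly_eq (f := f - ⟨q, hq⟩ * (X 0 ^ d + w)) h
  refine ⟨⟨q, hq⟩ * u, P, hP, ?_⟩
  rw [hPe, mul_assoc, hu]
  ring

/-- Uniqueness in Weierstrass division. -/
theorem IsRegularOfOrder.eq_zero_of_mul_eq [CompleteSpace 𝕜] {d : ℕ}
    {g q : ConvergentSeries 𝕜 (n + 1)} (hg : IsRegularOfOrder d g)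
    {P : Polynomial (ConvergentSeries 𝕜 n)} (hP : P.degree < d) (h : q * g = ofPoly P) :
    P = 0 := by
  obtain ⟨u, w, hw0, hu⟩ := hg.exists_unit_mul_eq
  set v := q * (↑u⁻¹ : ConvergentSeries 𝕜 (n + 1)) with hv
  have h1 : v * (X 0 ^ d + w) = ofPoly P := by
    rw [← hu, ← h, hv, mul_assoc, Units.inv_mul_cancel_left]
  have h2 : v.1 = 0 := MvPowerSeries.eq_zero_of_shift_mul_eq_zero w.2 v.2 hw0 (d := d) (by
    have := shift_ofPoly_eq_zero hP
    rwa [← h1] at this)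
  have h3 : v = 0 := Subtype.ext h2
  rw [h3, zero_mul] at h1
  exact ofPoly_injective (by rw [← h1, map_zero])

end ConvergentSeries

/-! ### Weierstrass preparation and transfer of primes -/

namespace ConvergentSeries

variable {𝕜 : Type*} [NormedField 𝕜] {n : ℕ}

/-- Restriction to the `x₀`-axis. -/
noncomputable def axis : ConvergentSeries 𝕜 (n + 1) →+* PowerSeries 𝕜 :=
  (PowerSeries.map MvPowerSeries.constantCoeff).comp
    ((MvPowerSeries.finSuccEquiv 𝕜 n).toRingEquiv.toRingHom.comp
      (ConvergentSeries 𝕜 (n + 1)).val.toRingHom)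

theorem coeff_axis (k : ℕ) (f : ConvergentSeries 𝕜 (n + 1)) :
    PowerSeries.coeff k (axis f) = MvPowerSeries.coeff (Finsupp.single 0 k) f.1 := by
  rw [← Finsupp.cons_zero_eq_single_zero, ← MvPowerSeries.coeff_coeff_finSuccEquiv]
  exact PowerSeries.coeff_map (MvPowerSeries.constantCoeff (σ := Fin n) (R := 𝕜)) k
    (MvPowerSeries.finSuccEquiv 𝕜 n f.1)

theorem isRegularOfOrder_iff {d : ℕ} {g : ConvergentSeries 𝕜 (n + 1)} :
    IsRegularOfOrder d g ↔ (axis g).order = d := by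
  rw [PowerSeries.order_eq_nat]
  simp only [coeff_axis, IsRegularOfOrder]
  tauto

theorem axis_ofPoly (P : Polynomial (ConvergentSeries 𝕜 n)) :
    axis (ofPoly P) = (P.map evalZero : Polynomial 𝕜) := by
  ext k
  rw [coeff_axis, ← Finsupp.cons_zero_eq_single_zero, coeff_cons_ofPoly, Polynomial.coeff_coe,
    Polynomial.coeff_map]
  rfl

theorem axis_X_zero : axis (X 0 : ConvergentSeries 𝕜 (n + 1)) = PowerSeries.X := by
  rw [← ofPoly_X, axis_ofPoly]
  simp

theorem axis_X_succ (i : Fin n) : axis (X i.succ : ConvergentSeries 𝕜 (n + 1)) = 0 := by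
  have h : (X i.succ : ConvergentSeries 𝕜 (n + 1)) = ofPoly (Polynomial.C (X i)) := by
    rw [ofPoly_C, liftSucc, substHom_X]
  rw [h, axis_ofPoly, Polynomial.map_C, evalZero_X]
  simp

theorem constantCoeff_axis (g : ConvergentSeries 𝕜 (n + 1)) :
    PowerSeries.constantCoeff (axis g) = MvPowerSeries.constantCoeff g.1 := by
  rw [← PowerSeries.coeff_zero_eq_constantCoeff_apply, coeff_axis]
  simp

/-- A monic polynomial over `𝕜{x₁, …, xₙ}` whose lower coefficients vanish at the origin. -/
structure IsWeierstrass (P : Polynomial (ConvergentSeries 𝕜 n)) : Prop where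
  monic : P.Monic
  map_eq : P.map evalZero = Polynomial.X ^ P.natDegree

theorem IsWeierstrass.isRegularOfOrder {P : Polynomial (ConvergentSeries 𝕜 n)}
    (hP : IsWeierstrass P) : IsRegularOfOrder P.natDegree (ofPoly P) := by
  rw [isRegularOfOrder_iff, axis_ofPoly, hP.map_eq]
  simp [PowerSeries.order_X_pow]

theorem ofPoly_sub (P Q : Polynomial (ConvergentSeries 𝕜 n)) :
    ofPoly (P - Q) = ofPoly P - ofPoly Q :=
  RingHom.map_sub ofPoly P Q

/-- Weierstrass preparation. -/
theorem IsRegularOfOrder.exists_associated_ofPoly [CompleteSpace 𝕜] {d : ℕ}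
    {g : ConvergentSeries 𝕜 (n + 1)} (hg : IsRegularOfOrder d g) :
    ∃ P : Polynomial (ConvergentSeries 𝕜 n), IsWeierstrass P ∧ P.natDegree = d ∧
      Associated (ofPoly P) g := by
  -- The Weierstrass polynomial is `x₀ ^ d - r`, with `r` the remainder of `x₀ ^ d` on division by
  -- `g`.
  obtain ⟨q, r, hr, h⟩ := hg.exists_eq_mul_add (X 0 ^ d)
  have hax := congrArg axis h
  rw [map_pow, axis_X_zero, map_add, map_mul, axis_ofPoly] at hax
  have hord := isRegularOfOrder_iff.1 hg
  have hdvd : (PowerSeries.X : PowerSeries 𝕜) ^ d ∣ axis g :=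
    PowerSeries.X_pow_dvd_iff.2 fun m hm => by rw [coeff_axis]; exact hg.1 m hm
  have hdr : (PowerSeries.X : PowerSeries 𝕜) ^ d ∣ ((r.map evalZero : Polynomial 𝕜) : PowerSeries 𝕜) := by
    rw [← dvd_add_right (hdvd.mul_left (axis q)), ← hax]
  -- On the axis, `r` has degree below `d` and is divisible by `X ^ d`.
  have hr0 : r.map evalZero = 0 := by
    ext m
    rcases lt_or_ge m d with hm | hm
    · have := PowerSeries.X_pow_dvd_iff.1 hdr m hm
      simpa using this
    · rw [Polynomial.coeff_map, Polynomial.coeff_eq_zero_of_degree_lt, map_zero, Polynomial.coeff_zero]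
      exact hr.trans_le (by exact_mod_cast hm)
  rw [hr0, Polynomial.coe_zero, add_zero] at hax
  -- On the axis `X ^ d = q g` with `g` of order `d`, so `q` has order zero there.
  have hq : IsUnit q := by
    rw [isUnit_iff, ← constantCoeff_axis]
    have h1 := congrArg PowerSeries.order hax
    rw [PowerSeries.order_X_pow, PowerSeries.order_mul, hord] at h1
    have h2 : (axis q).order = 0 := by
      have h3 : (0 : ℕ∞) + d = (axis q).order + d := by rw [zero_add]; exact h1
      exact ((ENat.add_left_injective_of_ne_top (ENat.natCast_ne_top d)) h3).symm
    rw [← PowerSeries.coeff_zero_eq_constantCoeff_apply]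
    exact (PowerSeries.order_eq_nat.1 h2).1
  have hmonic : (Polynomial.X ^ d - r).Monic := Polynomial.monic_X_pow_sub hr
  have hdeg : (Polynomial.X ^ d - r).natDegree = d := by
    rw [Polynomial.natDegree_eq_of_degree_eq_some (n := d)]
    rw [Polynomial.degree_sub_eq_left_of_degree_lt] <;> simp [hr]
  refine ⟨Polynomial.X ^ d - r, ⟨hmonic, ?_⟩, hdeg, ?_⟩
  · rw [hdeg, Polynomial.map_sub, hr0]
    simp
  · obtain ⟨u, rfl⟩ := hq
    refine Associated.symm ⟨u, ?_⟩
    rw [ofPoly_sub, map_pow, ofPoly_X, h]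
    ring

/-- The remainder of `Q` under polynomial division by the monic `P` is also a multiple of `P` as a
series, so uniqueness of Weierstrass division makes it vanish. -/
theorem IsWeierstrass.dvd_of_ofPoly_dvd [CompleteSpace 𝕜] {P Q : Polynomial (ConvergentSeries 𝕜 n)}
    (hP : IsWeierstrass P) (h : ofPoly P ∣ ofPoly Q) : P ∣ Q := by
  obtain ⟨q, hq⟩ := h
  rw [← Polynomial.modByMonic_eq_zero_iff_dvd hP.monic]
  refine hP.isRegularOfOrder.eq_zero_of_mul_eq (q := q - ofPoly (Q /ₘ P)) ?_ ?_
  · rw [← Polynomial.degree_eq_natDegree hP.monic.ne_zero]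
    exact Polynomial.degree_modByMonic_lt Q hP.monic
  · rw [Polynomial.modByMonic_eq_sub_mul_div, ofPoly_sub, map_mul, hq]
    ring

/-- Weierstrass division replaces both factors of a product by polynomials modulo `P`, where
primality in the polynomial ring applies. -/
theorem IsWeierstrass.prime_ofPoly [CompleteSpace 𝕜] {P : Polynomial (ConvergentSeries 𝕜 n)}
    (hP : IsWeierstrass P) (hp : Prime P) : Prime (ofPoly P) := by
  refine ⟨fun h => hp.ne_zero (ofPoly_injective (by rw [h, map_zero])), fun h => ?_, fun a b h => ?_⟩
  · have : ofPoly P ∣ ofPoly 1 := by rw [map_one]; exact h.dvd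
    exact hp.not_isUnit (isUnit_of_dvd_one (hP.dvd_of_ofPoly_dvd this))
  · obtain ⟨qa, ra, -, ha⟩ := hP.isRegularOfOrder.exists_eq_mul_add a
    obtain ⟨qb, rb, -, hb⟩ := hP.isRegularOfOrder.exists_eq_mul_add b
    have hab : ofPoly P ∣ ofPoly (ra * rb) := by
      have h1 : ofPoly (ra * rb) =
          a * b - ofPoly P * (qa * b + ofPoly ra * qb) := by
        rw [map_mul]
        conv_rhs => rw [ha, hb]
        ring
      rw [h1]
      exact dvd_sub h (dvd_mul_right _ _)
    rcases hp.dvd_or_dvd (hP.dvd_of_ofPoly_dvd hab) with h1 | h1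
    · left
      rw [ha]
      exact dvd_add (dvd_mul_left _ _) (map_dvd ofPoly h1)
    · right
      rw [hb]
      exact dvd_add (dvd_mul_left _ _) (map_dvd ofPoly h1)

/-- The leading coefficient of a divisor of a monic polynomial is a unit and can be normalised to
`1`. At the origin the divisor becomes a monic divisor of a power of `X`, hence a power of `X`. -/
theorem IsWeierstrass.exists_associated_of_dvd [CompleteSpace 𝕜]
    {P Q : Polynomial (ConvergentSeries 𝕜 n)} (hP : IsWeierstrass P) (h : Q ∣ P) :
    ∃ Q' : Polynomial (ConvergentSeries 𝕜 n), IsWeierstrass Q' ∧ Associated Q' Q := by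
  obtain ⟨R, hR⟩ := h
  have hlc : Q.leadingCoeff * R.leadingCoeff = 1 := by
    rw [← Polynomial.leadingCoeff_mul, ← hR, hP.monic.leadingCoeff]
  set Q' := Q * Polynomial.C R.leadingCoeff with hQ'
  have hm : Q'.Monic := by
    rw [hQ', Polynomial.Monic, Polynomial.leadingCoeff_mul, Polynomial.leadingCoeff_C, hlc]
  have hu : IsUnit (Polynomial.C R.leadingCoeff) :=
    (IsUnit.of_mul_eq_one _ ((mul_comm _ _).trans hlc)).map Polynomial.C
  have hass : Associated Q' Q := by
    obtain ⟨u, hu⟩ := hu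
    exact Associated.symm ⟨u, by rw [hu]⟩
  refine ⟨Q', ⟨hm, ?_⟩, hass⟩
  have hd : Q'.map evalZero ∣ Polynomial.X ^ P.natDegree := by
    rw [← hP.map_eq]
    exact map_dvd (Polynomial.mapRingHom evalZero) (hass.dvd.trans ⟨R, hR⟩)
  obtain ⟨i, -, hi⟩ := (dvd_prime_pow Polynomial.prime_X _).1 hd
  have he := Polynomial.eq_of_monic_of_associated (hm.map evalZero) (Polynomial.monic_X_pow i) hi
  have hdeg := congrArg Polynomial.natDegree he
  rw [hm.natDegree_map, Polynomial.natDegree_X_pow] at hdeg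
  rw [he, hdeg]

/-- Factor the associated Weierstrass polynomial over the factorial ring `𝕜{x₁, …, xₙ}` (Gauss). Its
prime factors are Weierstrass up to units and so remain prime as series. -/
theorem IsRegularOfOrder.exists_prime_factors [CompleteSpace 𝕜]
    [UniqueFactorizationMonoid (ConvergentSeries 𝕜 n)] {d : ℕ}
    {g : ConvergentSeries 𝕜 (n + 1)} (hg : IsRegularOfOrder d g) :
    ∃ s : Multiset (ConvergentSeries 𝕜 (n + 1)), (∀ b ∈ s, Prime b) ∧ Associated s.prod g := by
  obtain ⟨P, hP, -, hPg⟩ := hg.exists_associated_ofPoly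
  obtain ⟨s, hs, hsP⟩ := UniqueFactorizationMonoid.exists_prime_factors P hP.monic.ne_zero
  refine ⟨s.map ofPoly, fun b hb => ?_, ?_⟩
  · obtain ⟨Q, hQ, rfl⟩ := Multiset.mem_map.1 hb
    obtain ⟨Q', hQ', hass⟩ :=
      hP.exists_associated_of_dvd ((Multiset.dvd_prod hQ).trans hsP.dvd)
    exact (hass.map ofPoly).prime (hQ'.prime_ofPoly (hass.symm.prime (hs Q hQ)))
  · rw [← map_multiset_prod]
    exact (hsP.map ofPoly).trans hPg

end ConvergentSeries

/-! ### Linear changes of coordinates and unique factorization -/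

namespace ConvergentSeries

variable {𝕜 : Type*} [NormedField 𝕜] {n : ℕ}

theorem evalZero_substHom {m : ℕ} (a : Fin m → ConvergentSeries 𝕜 n)
    (ha : ∀ i, evalZero (a i) = 0) {f : ConvergentSeries 𝕜 m} (hf : evalZero f = 0) :
    evalZero (substHom a ha f) = 0 := by
  rw [evalZero_apply, coe_substHom]
  exact MvPowerSeries.constantCoeff_subst_eq_zero
    (hasSubst_coe ha) ha hf

theorem substHom_substHom {m k : ℕ} (a : Fin m → ConvergentSeries 𝕜 n)
    (ha : ∀ i, evalZero (a i) = 0) (b : Fin k → ConvergentSeries 𝕜 m)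
    (hb : ∀ i, evalZero (b i) = 0) (f : ConvergentSeries 𝕜 k) :
    substHom a ha (substHom b hb f) =
      substHom (fun i => substHom a ha (b i)) (fun i => evalZero_substHom a ha (hb i)) f := by
  refine Subtype.ext ?_
  rw [coe_substHom, coe_substHom, coe_substHom, MvPowerSeries.subst_comp_subst_apply
    (hasSubst_coe hb)
    (hasSubst_coe ha)]
  congr 1
  funext i
  exact (coe_substHom a ha (b i)).symm

theorem substHom_eq_self (a : Fin n → ConvergentSeries 𝕜 n)
    (ha : ∀ i, evalZero (a i) = 0) (h : ∀ i, a i = X i) (f : ConvergentSeries 𝕜 n) :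
    substHom a ha f = f := by
  obtain rfl : a = X := funext h
  refine Subtype.ext ?_
  rw [coe_substHom]
  exact congrFun MvPowerSeries.subst_self f.1

/-- The images of the coordinates under the linear map that sends the `x₀`-axis to the line
spanned by `p`. -/
noncomputable def shearCoord (p : Fin (n + 1) → 𝕜) : Fin (n + 1) → ConvergentSeries 𝕜 (n + 1) :=
  Fin.cons (p 0 • X 0) fun i => X i.succ + p i.succ • X 0

theorem evalZero_shearCoord (p : Fin (n + 1) → 𝕜) (i : Fin (n + 1)) :
    evalZero (shearCoord p i) = 0 := by
  refine Fin.cases ?_ (fun j => ?_) i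
  · simp [shearCoord, evalZero_smul, evalZero_X]
  · simp [shearCoord, evalZero_smul, evalZero_X]

theorem substHom_shearCoord_comp {p q : Fin (n + 1) → 𝕜} (h0 : q 0 * p 0 = 1)
    (h : ∀ i : Fin n, p i.succ + q i.succ * p 0 = 0) (f : ConvergentSeries 𝕜 (n + 1)) :
    substHom (shearCoord p) (evalZero_shearCoord p)
      (substHom (shearCoord q) (evalZero_shearCoord q) f) = f := by
  rw [substHom_substHom]
  refine substHom_eq_self _ _ (fun i => ?_) f
  refine Fin.cases ?_ (fun j => ?_) i
  · simp only [shearCoord, Fin.cons_zero, map_smul, substHom_X]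
    rw [smul_smul, h0, one_smul]
  · simp only [shearCoord, Fin.cons_succ, map_add, map_smul, substHom_X, Fin.cons_zero]
    rw [smul_smul, add_assoc, ← add_smul, h j, zero_smul, add_zero]

/-- The linear change of coordinates that sends the `x₀`-axis to the line spanned by `p`. -/
noncomputable def shear (p : Fin (n + 1) → 𝕜) (hp : p 0 ≠ 0) :
    ConvergentSeries 𝕜 (n + 1) ≃ₐ[𝕜] ConvergentSeries 𝕜 (n + 1) :=
  AlgEquiv.ofAlgHom (substHom (shearCoord p) (evalZero_shearCoord p))
    (substHom (shearCoord (Fin.cons (p 0)⁻¹ fun i => -p i.succ * (p 0)⁻¹))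
      (evalZero_shearCoord _))
    (AlgHom.ext fun f => substHom_shearCoord_comp (by simp [hp]) (fun i => by simp [hp]) f)
    (AlgHom.ext fun f => substHom_shearCoord_comp (by simp [hp]) (by simp) f)

theorem axis_shearCoord (p : Fin (n + 1) → 𝕜) (i : Fin (n + 1)) :
    axis (shearCoord p i) = PowerSeries.C (p i) * PowerSeries.X := by
  have hs : ∀ (c : 𝕜) (a : ConvergentSeries 𝕜 (n + 1)),
      axis (c • a) = PowerSeries.C c * axis a := by
    intro c a
    ext k
    rw [PowerSeries.coeff_C_mul, coeff_axis, coeff_axis]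
    exact MvPowerSeries.coeff_smul _ _ _
  refine Fin.cases ?_ (fun j => ?_) i
  · simp [shearCoord, hs, axis_X_zero]
  · simp [shearCoord, hs, axis_X_zero, axis_X_succ]

/-- Restricting to the line spanned by `p` turns the degree `k` homogeneous part of `f`, evaluated
at `p`, into the coefficient of order `k`. -/
theorem coeff_axis_shear (p : Fin (n + 1) → 𝕜) (hp : p 0 ≠ 0) (f : ConvergentSeries 𝕜 (n + 1))
    (k : ℕ) : PowerSeries.coeff k (axis (shear p hp f)) =
      ∑ d ∈ Finset.finsuppAntidiag Finset.univ k, MvPowerSeries.coeff d f.1 * ∏ i, p i ^ d i := by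
  classical
  have hsub := hasSubst_coe (evalZero_shearCoord p)
  have hprod : ∀ d : Fin (n + 1) →₀ ℕ, MvPowerSeries.coeff (Finsupp.single 0 k)
      (d.prod fun s e => (shearCoord p s).1 ^ e) =
      if d.degree = k then ∏ i, p i ^ d i else 0 := by
    intro d
    have h1 : (d.prod fun s e => (shearCoord p s).1 ^ e) = (∏ i, shearCoord p i ^ d i).1 := by
      rw [Finsupp.prod_fintype _ _ (by simp)]
      exact (map_prod (ConvergentSeries 𝕜 (n + 1)).val (fun i => shearCoord p i ^ d i)
        Finset.univ).symm
    rw [h1, ← coeff_axis, map_prod]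
    simp only [map_pow, axis_shearCoord, mul_pow]
    rw [Finset.prod_mul_distrib, Finset.prod_pow_eq_pow_sum, ← Finsupp.degree_eq_sum]
    simp only [← map_pow]
    rw [← map_prod, PowerSeries.coeff_C_mul, PowerSeries.coeff_X_pow]
    simp [eq_comm]
  rw [coeff_axis]
  change MvPowerSeries.coeff _ (substHom (shearCoord p) (evalZero_shearCoord p) f).1 = _
  rw [coe_substHom, MvPowerSeries.coeff_subst hsub]
  simp only [hprod]
  rw [finsum_eq_sum_of_support_subset (s := Finset.finsuppAntidiag Finset.univ k)]
  · refine Finset.sum_congr rfl fun d hd => ?_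
    rw [Finset.mem_finsuppAntidiag] at hd
    rw [if_pos (by rw [Finsupp.degree_eq_sum]; exact hd.1), smul_eq_mul]
  · intro d hd
    rw [Finset.mem_coe, Finset.mem_finsuppAntidiag]
    refine ⟨?_, Finset.subset_univ _⟩
    rw [← Finsupp.degree_eq_sum]
    by_contra hne
    simp [hne] at hd

theorem exists_shear_isRegularOfOrder [Infinite 𝕜] {f : ConvergentSeries 𝕜 (n + 1)}
    (hf : f ≠ 0) : ∃ (p : Fin (n + 1) → 𝕜) (hp : p 0 ≠ 0) (d : ℕ),
      IsRegularOfOrder d (shear p hp f) := by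
  classical
  obtain ⟨ν, hν⟩ : ∃ ν, MvPowerSeries.coeff ν f.1 ≠ 0 := by
    by_contra! h
    exact hf (Subtype.ext (MvPowerSeries.ext h))
  set H : MvPolynomial (Fin (n + 1)) 𝕜 :=
    ∑ d ∈ Finset.finsuppAntidiag Finset.univ ν.degree,
      MvPolynomial.monomial d (MvPowerSeries.coeff d f.1) with hH
  have hH0 : H ≠ 0 := by
    intro h
    apply hν
    have := congrArg (MvPolynomial.coeff ν) h
    rw [hH, MvPolynomial.coeff_sum, Finset.sum_eq_single ν] at this
    · simpa using this
    · intro d _ hd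
      rw [MvPolynomial.coeff_monomial, if_neg hd]
    · intro h
      exact absurd (Finset.mem_finsuppAntidiag.2
        ⟨(Finsupp.degree_eq_sum ν).symm, Finset.subset_univ _⟩) h
  -- A nonzero polynomial over an infinite field has a non-root. The factor `X 0` secures `p 0 ≠ 0`,
  -- which makes the shear invertible.
  obtain ⟨p, hp⟩ : ∃ p : Fin (n + 1) → 𝕜, MvPolynomial.eval p (MvPolynomial.X 0 * H) ≠ 0 := by
    by_contra! h
    exact mul_ne_zero (MvPolynomial.X_ne_zero 0) hH0 (MvPolynomial.funext fun p => by simpa using h p)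
  rw [map_mul, MvPolynomial.eval_X] at hp
  have hp0 := left_ne_zero_of_mul hp
  have hne : axis (shear p hp0 f) ≠ 0 := by
    intro h
    apply right_ne_zero_of_mul hp
    have h1 := coeff_axis_shear p hp0 f ν.degree
    rw [h, map_zero] at h1
    rw [hH, map_sum, h1]
    refine Finset.sum_congr rfl fun d _ => ?_
    rw [MvPolynomial.eval_monomial, Finsupp.prod_fintype _ _ (by simp)]
  refine ⟨p, hp0, (axis (shear p hp0 f)).order.toNat, isRegularOfOrder_iff.2 ?_⟩
  exact (ENat.natCast_toNat (PowerSeries.order_eq_top.not.2 hne)).symm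

/-- Induction on the number of variables. For `n = 0` every nonzero element is a unit; in the step,
a shear makes the element regular in `x₀`, and primes are carried back by the inverse shear. -/
instance uniqueFactorizationMonoid {𝕜 : Type*} [NontriviallyNormedField 𝕜] [CompleteSpace 𝕜] :
    ∀ n : ℕ, UniqueFactorizationMonoid (ConvergentSeries 𝕜 n)
  | 0 => by
    refine UniqueFactorizationMonoid.of_exists_prime_factors fun a ha => ⟨0, by simp, ?_⟩
    rw [Multiset.prod_zero]
    refine Associated.symm (associated_one_iff_isUnit.2 (isUnit_iff.2 fun h => ha ?_))
    refine Subtype.ext (MvPowerSeries.ext fun ν => ?_)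
    rw [Subsingleton.elim ν 0]
    exact h
  | n + 1 => by
    have := uniqueFactorizationMonoid (𝕜 := 𝕜) n
    refine UniqueFactorizationMonoid.of_exists_prime_factors fun a ha => ?_
    obtain ⟨p, hp, d, hd⟩ := exists_shear_isRegularOfOrder ha
    obtain ⟨s, hs, hsa⟩ := hd.exists_prime_factors
    refine ⟨s.map (shear p hp).symm, fun b hb => ?_, ?_⟩
    · obtain ⟨c, hc, rfl⟩ := Multiset.mem_map.1 hb
      exact (MulEquiv.prime_iff (shear p hp).symm.toMulEquiv).2 (hs c hc)
    · have := hsa.map (shear p hp).symm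
      rwa [map_multiset_prod, AlgEquiv.symm_apply_apply] at this

end ConvergentSeries

/-! ### Lexicographic leading terms and derivatives -/

namespace MvPowerSeries

variable {𝕜 : Type*} [Field 𝕜] {n : ℕ}

/-- The Euler operator `xᵢ ∂ᵢ` is diagonal on monomials, hence compatible with leading terms in a
way that `∂ᵢ` is not. -/
theorem coeff_X_mul_pderiv (i : Fin n) (a : MvPowerSeries (Fin n) 𝕜) (ν : Fin n →₀ ℕ) :
    coeff ν (X i * pderiv 𝕜 i a) = ν i * coeff ν a := by
  classical
  rw [X_def, coeff_monomial_mul, one_mul]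
  split_ifs with h
  · rw [coeff_pderiv, tsub_add_cancel_of_le h]
    have h1 : 1 ≤ ν i := by simpa using h
    rw [Finsupp.tsub_apply, Finsupp.single_eq_same, Nat.cast_sub h1]
    push_cast
    ring
  · have : ν i = 0 := by
      by_contra h0
      exact h (by simpa using Nat.one_le_iff_ne_zero.2 h0)
    simp [this]

theorem le_lexOrder_X_mul_pderiv (i : Fin n) (a : MvPowerSeries (Fin n) 𝕜) :
    lexOrder a ≤ lexOrder (X i * pderiv 𝕜 i a) := by
  rw [le_lexOrder_iff]
  intro d hd
  rw [coeff_X_mul_pderiv, coeff_eq_zero_of_lt_lexOrder hd, mul_zero]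

theorem coeff_add_mul_of_le_lexOrder {φ ψ : MvPowerSeries (Fin n) 𝕜} {p q : Fin n →₀ ℕ}
    (hp : toLex p ≤ lexOrder φ) (hq : toLex q ≤ lexOrder ψ) :
    coeff (p + q) (φ * ψ) = coeff p φ * coeff q ψ := by
  classical
  rw [coeff_mul, Finset.sum_eq_single_of_mem ⟨p, q⟩ (by simp)]
  rintro ⟨u, v⟩ h h'
  rw [Finset.HasAntidiagonal.mem_antidiagonal] at h
  rcases trichotomy_of_add_eq_add (congrArg toLex h) with h'' | h'' | h''
  · exact absurd (Prod.ext h''.1 h''.2) h'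
  · rw [coeff_eq_zero_of_lt_lexOrder (d := u), zero_mul]
    exact lt_of_lt_of_le (by exact_mod_cast h'') hp
  · rw [coeff_eq_zero_of_lt_lexOrder (d := v), mul_zero]
    exact lt_of_lt_of_le (by exact_mod_cast h'') hq

theorem toLex_zero_le_lexOrder (φ : MvPowerSeries (Fin n) 𝕜) :
    ((toLex (0 : Fin n →₀ ℕ) : Lex (Fin n →₀ ℕ)) : WithTop (Lex (Fin n →₀ ℕ))) ≤ lexOrder φ := by
  rw [le_lexOrder_iff]
  intro d hd
  exact absurd (WithTop.coe_lt_coe.1 hd) not_lt_bot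

/-- With `∂ᵢ a = a b`, compare coefficients in `xᵢ ∂ᵢ a = a (xᵢ b)` at the leading exponent `ν` of
`a`: the left side gives `νᵢ` times the leading coefficient, the right side `0`. So `ν = 0`. -/
theorem constantCoeff_ne_zero_of_dvd_pderiv [CharZero 𝕜] {a : MvPowerSeries (Fin n) 𝕜}
    (ha : a ≠ 0) (h : ∀ i, a ∣ pderiv 𝕜 i a) : constantCoeff a ≠ 0 := by
  obtain ⟨ν, hν⟩ := exists_finsupp_eq_lexOrder_of_ne_zero ha
  have hc : coeff ν a ≠ 0 := coeff_ne_zero_of_lexOrder hν.symm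
  have hν0 : ν = 0 := by
    ext i
    obtain ⟨b, hb⟩ := h i
    have h1 : coeff (ν + 0) (a * (X i * b)) = coeff ν a * coeff 0 (X i * b) :=
      coeff_add_mul_of_le_lexOrder hν.ge (toLex_zero_le_lexOrder _)
    have h2 : a * (X i * b) = X i * pderiv 𝕜 i a := by rw [hb]; ring
    rw [h2, add_zero, coeff_X_mul_pderiv, coeff_zero_X_mul, mul_zero, mul_eq_zero] at h1
    simpa using h1.resolve_right hc
  rw [← coeff_zero_eq_constantCoeff_apply]
  rwa [hν0] at hc

/-- After multiplication by `xᵢ`, comparing the coefficients at the sum `ν + μ` of the leading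
exponents yields `νᵢ = μᵢ` for each `i`. -/
theorem lexOrder_eq_of_mul_pderiv_eq [CharZero 𝕜] {a b : MvPowerSeries (Fin n) 𝕜} (ha : a ≠ 0)
    (hb : b ≠ 0) (h : ∀ i, a * pderiv 𝕜 i b = b * pderiv 𝕜 i a) : lexOrder a = lexOrder b := by
  obtain ⟨ν, hν⟩ := exists_finsupp_eq_lexOrder_of_ne_zero ha
  obtain ⟨μ, hμ⟩ := exists_finsupp_eq_lexOrder_of_ne_zero hb
  have hca : coeff ν a ≠ 0 := coeff_ne_zero_of_lexOrder hν.symm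
  have hcb : coeff μ b ≠ 0 := coeff_ne_zero_of_lexOrder hμ.symm
  have : ν = μ := by
    ext i
    have h1 : coeff (ν + μ) (a * (X i * pderiv 𝕜 i b)) = coeff ν a * (μ i * coeff μ b) := by
      rw [coeff_add_mul_of_le_lexOrder hν.ge (hμ.ge.trans (le_lexOrder_X_mul_pderiv i b)),
        coeff_X_mul_pderiv]
    have h2 : coeff (ν + μ) ((X i * pderiv 𝕜 i a) * b) = ν i * coeff ν a * coeff μ b := by
      rw [coeff_add_mul_of_le_lexOrder (hν.ge.trans (le_lexOrder_X_mul_pderiv i a)) hμ.ge,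
        coeff_X_mul_pderiv]
    have h3 : a * (X i * pderiv 𝕜 i b) = (X i * pderiv 𝕜 i a) * b := by
      linear_combination X i * h i
    rw [h3, h2] at h1
    have h4 : ((ν i : 𝕜) - μ i) * (coeff ν a * coeff μ b) = 0 := by linear_combination h1
    have h5 := (mul_eq_zero.1 h4).resolve_right (mul_ne_zero hca hcb)
    exact_mod_cast sub_eq_zero.1 h5
  rw [hν, hμ, this]

/-- A quotient of power series whose differential vanishes is constant. -/
theorem exists_eq_smul_of_mul_pderiv_eq [CharZero 𝕜] {a b : MvPowerSeries (Fin n) 𝕜}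
    (ha : a ≠ 0) (h : ∀ i, a * pderiv 𝕜 i b = b * pderiv 𝕜 i a) : ∃ c : 𝕜, b = c • a := by
  obtain ⟨ν, hν⟩ := exists_finsupp_eq_lexOrder_of_ne_zero ha
  have hca : coeff ν a ≠ 0 := coeff_ne_zero_of_lexOrder hν.symm
  -- This constant cancels the coefficient of `b - c a` at `ν`. The difference satisfies the same
  -- equations, so if nonzero it would have leading exponent `ν`, a contradiction.
  refine ⟨coeff ν b / coeff ν a, ?_⟩
  by_contra hne
  have hne' := sub_ne_zero.2 hne
  have hord := lexOrder_eq_of_mul_pderiv_eq ha hne' fun i => by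
    rw [map_sub, Derivation.map_smul, smul_eq_C_mul, smul_eq_C_mul]
    linear_combination h i
  refine coeff_ne_zero_of_lexOrder (hν.symm.trans hord) ?_
  rw [map_sub, coeff_smul, div_mul_cancel₀ _ hca, sub_self]

end MvPowerSeries

/-! ### Derivations of `𝕜{x}` -/

namespace ConvergentSeries

variable {𝕜 : Type*} [NormedField 𝕜] {n : ℕ}

theorem evalZero_algebraMap (c : 𝕜) :
    evalZero (algebraMap 𝕜 (ConvergentSeries 𝕜 n) c) = c := by
  rw [Algebra.algebraMap_eq_smul_one, evalZero_smul, map_one, mul_one]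

/-- Hadamard's lemma: split off the multiples of `x₀`; what is left involves only the other
variables. -/
theorem exists_eq_sum_X_mul : ∀ {n : ℕ} (a : ConvergentSeries 𝕜 n),
    ∃ b : Fin n → ConvergentSeries 𝕜 n,
      a = algebraMap 𝕜 (ConvergentSeries 𝕜 n) (evalZero a) + ∑ i, X i * b i
  | 0, a => by
    refine ⟨Fin.elim0, Subtype.ext (MvPowerSeries.ext fun ν => ?_)⟩
    rw [Subsingleton.elim ν 0, Finset.univ_eq_empty, Finset.sum_empty, add_zero]
    exact (MvPowerSeries.coeff_zero_C _).symm
  | n + 1, a => by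
    have hs : MvPowerSeries.shift 1
        (a - X 0 * ⟨_, MvPowerSeries.isConvergentSeries_shift a.2 1⟩ :
          ConvergentSeries 𝕜 (n + 1)).1 = 0 := by
      have := MvPowerSeries.shift_X_pow_mul 1 (MvPowerSeries.shift 1 a.1)
      rw [pow_one] at this
      refine (map_sub (MvPowerSeries.shift 1) a.1 _).trans (sub_eq_zero.2 this.symm)
    obtain ⟨P, hP, hPa⟩ := exists_ofPoly_eq hs
    have hP0 : P = Polynomial.C (P.coeff 0) :=
      Polynomial.eq_C_of_degree_le_zero (Order.le_of_lt_succ (by exact_mod_cast hP))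
    obtain ⟨b, hb⟩ := exists_eq_sum_X_mul (P.coeff 0)
    rw [hP0, ofPoly_C, hb] at hPa
    let B : Fin (n + 1) → ConvergentSeries 𝕜 (n + 1) :=
      Fin.cons ⟨_, MvPowerSeries.isConvergentSeries_shift a.2 1⟩ fun i => liftSucc (b i)
    have key : a = algebraMap 𝕜 (ConvergentSeries 𝕜 (n + 1)) (evalZero (P.coeff 0)) +
        ∑ i, X i * B i := by
      rw [Fin.sum_univ_succ]
      simp only [B, Fin.cons_zero, Fin.cons_succ]
      rw [map_add, AlgHom.commutes, map_sum] at hPa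
      simp only [map_mul, liftSucc, substHom_X] at hPa
      rw [eq_comm, sub_eq_iff_eq_add] at hPa
      refine hPa.trans ?_
      rw [liftSucc]
      ring
    have h0 : evalZero a = evalZero (P.coeff 0) := by
      have h1 := congrArg evalZero key
      rw [map_add, map_sum] at h1
      simp only [map_mul, evalZero_X, zero_mul, Finset.sum_const_zero, add_zero] at h1
      rw [h1]
      exact evalZero_algebraMap _
    exact ⟨B, by rw [h0]; exact key⟩

/-- No continuity of `D` is assumed. Writing `a = a(0) + ∑ xᵢ bᵢ` gives `D a = ∑ xᵢ D bᵢ`, and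
iterating pushes `D a` into every power of the maximal ideal. -/
theorem derivation_eq_zero (D : Derivation 𝕜 (ConvergentSeries 𝕜 n) (ConvergentSeries 𝕜 n))
    (hD : ∀ i, D (X i) = 0) (a : ConvergentSeries 𝕜 n) : D a = 0 := by
  classical
  have key : ∀ (k : ℕ) (a : ConvergentSeries 𝕜 n) (ν : Fin n →₀ ℕ), ν.degree < k →
      MvPowerSeries.coeff ν (D a).1 = 0 := by
    intro k
    induction k with
    | zero => intro a ν hν; omega
    | succ k ih =>
      intro a ν hν
      obtain ⟨b, hb⟩ := exists_eq_sum_X_mul a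
      have h1 : D a = ∑ i, X i * D (b i) := by
        rw [hb, map_add, Derivation.map_algebraMap, zero_add, map_sum]
        refine Finset.sum_congr rfl fun i _ => ?_
        rw [Derivation.leibniz, hD, smul_zero, add_zero, smul_eq_mul]
      have h2 : (D a).1 = ∑ i, MvPowerSeries.X i * (D (b i)).1 := by
        rw [h1]
        exact map_sum (ConvergentSeries 𝕜 n).val (fun i => X i * D (b i)) Finset.univ
      rw [h2, map_sum]
      refine Finset.sum_eq_zero fun i _ => ?_
      rw [MvPowerSeries.X_def, MvPowerSeries.coeff_monomial_mul]
      split_ifs with h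
      · rw [ih, mul_zero]
        have h3 := congrArg Finsupp.degree (tsub_add_cancel_of_le h)
        rw [map_add, Finsupp.degree_single] at h3
        omega
      · rfl
  exact Subtype.ext (MvPowerSeries.ext fun ν => key (ν.degree + 1) a ν (Nat.lt_succ_self _))

theorem pderiv_X_self (i : Fin n) : pderiv i (X i : ConvergentSeries 𝕜 n) = 1 :=
  Subtype.ext MvPowerSeries.pderiv_X_self

theorem pderiv_X_of_ne {i j : Fin n} (h : j ≠ i) : pderiv i (X j : ConvergentSeries 𝕜 n) = 0 :=
  Subtype.ext (MvPowerSeries.pderiv_X_of_ne h)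

theorem derivation_eq_sum (D : Derivation 𝕜 (ConvergentSeries 𝕜 n) (ConvergentSeries 𝕜 n))
    (a : ConvergentSeries 𝕜 n) : D a = ∑ i, D (X i) * pderiv i a := by
  have hsum : ∀ b, (∑ i, D (X i) • pderivDerivation i) b = ∑ i, D (X i) * pderiv i b := fun b => by
    have := map_sum (Derivation.coeFnAddMonoidHom (R := 𝕜) (A := ConvergentSeries 𝕜 n)
      (M := ConvergentSeries 𝕜 n)) (fun i => D (X i) • pderivDerivation i) Finset.univ
    exact (congrFun this b).trans (Finset.sum_apply _ _ _)
  have h := derivation_eq_zero (D - ∑ i, D (X i) • pderivDerivation i) (fun j => ?_) a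
  · rw [Derivation.sub_apply, sub_eq_zero] at h
    rw [h, hsum]
  · rw [Derivation.sub_apply, hsum, Finset.sum_eq_single j]
    · simp [pderiv_X_self]
    · intro i _ hi
      simp [pderiv_X_of_ne hi.symm]
    · simp

theorem exists_not_dvd_pderiv [CompleteSpace 𝕜] [CharZero 𝕜] {a : ConvergentSeries 𝕜 n}
    (ha : a ≠ 0) (hu : ¬ IsUnit a) : ∃ i, ¬ a ∣ pderiv i a := by
  by_contra! h
  refine hu (isUnit_iff.2 (MvPowerSeries.constantCoeff_ne_zero_of_dvd_pderiv ?_ fun i => ?_))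
  · exact fun h0 => ha (Subtype.ext h0)
  · exact map_dvd (ConvergentSeries 𝕜 n).val (h i)

theorem exists_eq_smul_of_mul_pderiv_eq [CharZero 𝕜] {a b : ConvergentSeries 𝕜 n}
    (ha : a ≠ 0) (h : ∀ i, a * pderiv i b = b * pderiv i a) : ∃ c : 𝕜, b = c • a := by
  obtain ⟨c, hc⟩ := MvPowerSeries.exists_eq_smul_of_mul_pderiv_eq (a := a.1) (b := b.1)
    (fun h0 => ha (Subtype.ext h0)) fun i => congrArg Subtype.val (h i)
  exact ⟨c, Subtype.ext hc⟩

end ConvergentSeries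

/-! ### Constancy of `f / g` along a prime -/

namespace ConvergentSeries

section

variable {𝕜 : Type*} [NormedField 𝕜] {n : ℕ}

theorem coeff_pderiv (i : Fin n) (a : ConvergentSeries 𝕜 n) (ν : Fin n →₀ ℕ) :
    MvPowerSeries.coeff ν (pderiv i a).1 =
      MvPowerSeries.coeff (ν + Finsupp.single i 1) a.1 * (ν i + 1) :=
  MvPowerSeries.coeff_pderiv a.1 ν

theorem pderiv_zero_ofPoly (P : Polynomial (ConvergentSeries 𝕜 n)) :
    pderiv 0 (ofPoly P) = ofPoly (Polynomial.derivative P) := by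
  refine Subtype.ext (MvPowerSeries.ext fun ν => ?_)
  rw [coeff_pderiv, ← Finsupp.cons_tail ν]
  have h : Finsupp.cons (ν 0) ν.tail + Finsupp.single 0 1 = Finsupp.cons (ν 0 + 1) ν.tail := by
    ext i
    refine Fin.cases ?_ (fun j => ?_) i <;> simp [Finsupp.tail_apply]
  rw [h, coeff_cons_ofPoly, coeff_cons_ofPoly, Polynomial.coeff_derivative, Finsupp.cons_zero]
  have h2 : (P.coeff (ν 0 + 1) * ((ν 0 : ConvergentSeries 𝕜 n) + 1)) =
      ((ν 0 : 𝕜) + 1) • P.coeff (ν 0 + 1) := by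
    rw [Algebra.smul_def]
    push_cast
    ring
  rw [h2]
  refine Eq.trans ?_ (MvPowerSeries.coeff_smul _ _ _).symm
  ring

theorem pderiv_zero_liftSucc (a : ConvergentSeries 𝕜 n) : pderiv 0 (liftSucc a) = 0 := by
  rw [← ofPoly_C, pderiv_zero_ofPoly, Polynomial.derivative_C, map_zero]

theorem pderiv_succ_liftSucc (i : Fin n) (a : ConvergentSeries 𝕜 n) :
    pderiv i.succ (liftSucc a) = liftSucc (pderiv i a) := by
  rw [← ofPoly_C, ← ofPoly_C]
  refine Subtype.ext (MvPowerSeries.ext fun ν => ?_)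
  rw [coeff_pderiv, ← Finsupp.cons_tail ν]
  have h : Finsupp.cons (ν 0) ν.tail + Finsupp.single i.succ 1 =
      Finsupp.cons (ν 0) (ν.tail + Finsupp.single i 1) := by
    ext j
    refine Fin.cases ?_ (fun k => ?_) j
    · simp
    · simp [Finsupp.single_apply, Finsupp.tail_apply]
  rw [h, coeff_cons_ofPoly, coeff_cons_ofPoly, Polynomial.coeff_C, Polynomial.coeff_C,
    Finsupp.cons_succ]
  split_ifs
  · rw [coeff_pderiv]
  · simp

/-- The homogeneous form `∑ⱼ aⱼ f ^ j g ^ (e - j)` with coefficients in `𝕜{x₁, …, xₙ}`. -/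
noncomputable def binaryForm (f g : ConvergentSeries 𝕜 (n + 1)) (e : ℕ)
    (a : ℕ → ConvergentSeries 𝕜 n) : ConvergentSeries 𝕜 (n + 1) :=
  ∑ j ∈ Finset.range (e + 1), liftSucc (a j) * (f ^ j * g ^ (e - j))

/-- Modulo `h` the logarithmic derivatives of `f` and `g` agree, so each monomial of degree `j + k`
in them has logarithmic derivative `(j + k) D g / g`. -/
theorem dvd_mul_derivation_pow_mul_pow {R A : Type*} [CommRing R] [CommRing A] [Algebra R A]
    (D : Derivation R A A) {h f g : A} (hD : h ∣ g * D f - f * D g) (j k : ℕ) :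
    h ∣ g * D (f ^ j * g ^ k) - (j + k : ℕ) * D g * (f ^ j * g ^ k) := by
  obtain ⟨m, hm⟩ := hD
  have hj : f * (f ^ (j - 1) * (j : A)) = (j : A) * f ^ j := by
    cases j with
    | zero => simp
    | succ j => rw [Nat.add_sub_cancel]; ring
  have hk : g * (g ^ (k - 1) * (k : A)) = (k : A) * g ^ k := by
    cases k with
    | zero => simp
    | succ k => rw [Nat.add_sub_cancel]; ring
  refine ⟨m * (j * f ^ (j - 1) * g ^ k), ?_⟩
  rw [Derivation.leibniz, Derivation.leibniz_pow, Derivation.leibniz_pow]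
  simp only [smul_eq_mul, nsmul_eq_mul, Nat.cast_add]
  linear_combination (j * f ^ (j - 1) * g ^ k) * hm + (g ^ k * D g) * hj + (f ^ j * D g) * hk

/-- The field `δ = ∂₀h ∂ᵢ - ∂ᵢh ∂₀` is tangent to `h`, so it preserves the relation. Up to multiples
of the relation it differentiates only the coefficients, which do not involve `x₀`; the factor `g
∂₀h` cancels by primality. -/
theorem dvd_binaryForm_pderiv {h f g : ConvergentSeries 𝕜 (n + 1)} (hh : Prime h)
    (hg : ¬ h ∣ g) (h0 : ¬ h ∣ pderiv 0 h)
    (hD : ∀ D : Derivation 𝕜 (ConvergentSeries 𝕜 (n + 1)) (ConvergentSeries 𝕜 (n + 1)),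
      h ∣ g * D f - f * D g) {e : ℕ} {a : ℕ → ConvergentSeries 𝕜 n}
    (ha : h ∣ binaryForm f g e a) (i : Fin n) :
    h ∣ binaryForm f g e fun j => pderiv i (a j) := by
  set δ : Derivation 𝕜 (ConvergentSeries 𝕜 (n + 1)) (ConvergentSeries 𝕜 (n + 1)) :=
    pderiv 0 h • pderivDerivation i.succ - pderiv i.succ h • pderivDerivation 0 with hδ
  have hδa : ∀ b, δ (liftSucc b) = pderiv 0 h * liftSucc (pderiv i b) := fun b => by
    simp [hδ, pderiv_zero_liftSucc, pderiv_succ_liftSucc]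
  have hδh : δ h = 0 := by
    simp only [hδ, Derivation.sub_apply, Derivation.smul_apply, pderivDerivation_apply,
      smul_eq_mul]
    ring
  have h1 : h ∣ δ (binaryForm f g e a) := by
    obtain ⟨m, hm⟩ := ha
    rw [hm, Derivation.leibniz, hδh, smul_zero, add_zero]
    exact dvd_mul_right _ _
  have h2 : h ∣ g * δ (binaryForm f g e a) - e * δ g * binaryForm f g e a -
      pderiv 0 h * g * binaryForm f g e fun j => pderiv i (a j) := by
    simp only [binaryForm]
    rw [map_sum, Finset.mul_sum, Finset.mul_sum, Finset.mul_sum, ← Finset.sum_sub_distrib,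
      ← Finset.sum_sub_distrib]
    refine Finset.dvd_sum fun j hj => ?_
    have hje : j + (e - j) = e := by
      have := Finset.mem_range.1 hj
      omega
    have h3 := dvd_mul_derivation_pow_mul_pow δ (hD δ) j (e - j)
    rw [hje] at h3
    have h4 : g * δ (liftSucc (a j) * (f ^ j * g ^ (e - j))) -
        e * δ g * (liftSucc (a j) * (f ^ j * g ^ (e - j))) -
        pderiv 0 h * g * (liftSucc (pderiv i (a j)) * (f ^ j * g ^ (e - j))) =
        liftSucc (a j) *
          (g * δ (f ^ j * g ^ (e - j)) - e * δ g * (f ^ j * g ^ (e - j))) := by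
      rw [Derivation.leibniz, hδa, smul_eq_mul, smul_eq_mul]
      ring
    rw [h4]
    exact h3.mul_left _
  have h5 : h ∣ pderiv 0 h * g * binaryForm f g e fun j => pderiv i (a j) :=
    (dvd_sub_right (dvd_sub (h1.mul_left g) (ha.mul_left _))).1 h2
  rcases hh.dvd_or_dvd h5 with h6 | h6
  · exact ((hh.dvd_or_dvd h6).elim h0 hg).elim
  · exact h6

/-- The remainders of the `d + 1` products `f ^ j g ^ (d - j)` modulo `P` lie in a free module of
rank `d`, hence are linearly dependent over `𝕜{x₁, …, xₙ}`. -/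
theorem exists_dvd_binaryForm [CompleteSpace 𝕜] {P : Polynomial (ConvergentSeries 𝕜 n)}
    (hP : IsWeierstrass P) (f g : ConvergentSeries 𝕜 (n + 1)) :
    ∃ (e : ℕ) (a : ℕ → ConvergentSeries 𝕜 n), (∃ j ≤ e, a j ≠ 0) ∧
      ofPoly P ∣ binaryForm f g e a := by
  set d := P.natDegree with hd
  choose q r hr hqr using fun j => hP.isRegularOfOrder.exists_eq_mul_add (f ^ j * g ^ (d - j))
  let v : Fin (d + 1) → Fin d → ConvergentSeries 𝕜 n := fun j k => (r j).coeff k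
  have hv : ¬ LinearIndependent (ConvergentSeries 𝕜 n) v := by
    intro hli
    have := hli.fintype_card_le_finrank
    simp at this
  obtain ⟨c, hc, j₀, hj₀⟩ := Fintype.not_linearIndependent_iff.1 hv
  refine ⟨d, fun j => if h : j < d + 1 then c ⟨j, h⟩ else 0, ⟨j₀, Nat.lt_succ_iff.1 j₀.2, ?_⟩, ?_⟩
  · dsimp only
    rwa [dif_pos j₀.2]
  · have hrel : ∑ j : Fin (d + 1), Polynomial.C (c j) * r j = 0 := by
      ext k : 1
      rw [Polynomial.finsetSum_coeff, Polynomial.coeff_zero]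
      rcases lt_or_ge k d with hk | hk
      · have := congrFun hc ⟨k, hk⟩
        simpa [v, Finset.sum_apply] using this
      · refine Finset.sum_eq_zero fun j _ => ?_
        rw [Polynomial.coeff_C_mul, Polynomial.coeff_eq_zero_of_degree_lt, mul_zero]
        exact (hr j).trans_le (by exact_mod_cast hk)
    rw [binaryForm, Finset.sum_range]
    have h1 : ∀ j : Fin (d + 1),
        liftSucc (if h : (j : ℕ) < d + 1 then c ⟨j, h⟩ else 0) * (f ^ (j : ℕ) * g ^ (d - j)) =
        ofPoly P * (liftSucc (c j) * q j) + ofPoly (Polynomial.C (c j) * r j) := by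
      intro j
      rw [dif_pos j.2, hqr, map_mul, ofPoly_C]
      ring
    simp only [h1]
    rw [Finset.sum_add_distrib, ← map_sum ofPoly, hrel, map_zero, add_zero]
    exact Finset.dvd_sum fun j _ => dvd_mul_right _ _

theorem IsWeierstrass.natDegree_pos {P : Polynomial (ConvergentSeries 𝕜 n)}
    (hP : IsWeierstrass P) (hu : ¬ IsUnit (ofPoly P)) : 0 < P.natDegree := by
  rw [Nat.pos_iff_ne_zero]
  intro h
  rw [hP.monic.natDegree_eq_zero] at h
  rw [h, map_one] at hu
  exact hu isUnit_one

theorem IsWeierstrass.not_dvd_liftSucc [CompleteSpace 𝕜] {P : Polynomial (ConvergentSeries 𝕜 n)}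
    (hP : IsWeierstrass P) (hd : 0 < P.natDegree) {a : ConvergentSeries 𝕜 n} (ha : a ≠ 0) :
    ¬ ofPoly P ∣ liftSucc a := by
  rw [← ofPoly_C]
  intro h
  have := Polynomial.eq_zero_of_dvd_of_natDegree_lt (hP.dvd_of_ofPoly_dvd h) (by simpa using hd)
  exact ha (Polynomial.C_eq_zero.1 this)

theorem IsWeierstrass.not_dvd_pderiv_zero [CompleteSpace 𝕜] [CharZero 𝕜]
    {P : Polynomial (ConvergentSeries 𝕜 n)}
    (hP : IsWeierstrass P) (hd : 0 < P.natDegree) : ¬ ofPoly P ∣ pderiv 0 (ofPoly P) := by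
  rw [pderiv_zero_ofPoly]
  intro h
  have hlt := Polynomial.natDegree_derivative_lt hd.ne'
  have h0 := Polynomial.eq_zero_of_dvd_of_natDegree_lt (hP.dvd_of_ofPoly_dvd h) hlt
  have : CharZero (ConvergentSeries 𝕜 n) := algebraRat.charZero _
  exact hd.ne' (Polynomial.derivative_eq_zero.1 h0)

/-- An algebraic relation of minimal degree between `f` and `g` modulo `h` has constant
coefficients if `f / g` is constant along `h`. -/
theorem exists_dvd_sum_smul [CompleteSpace 𝕜] [CharZero 𝕜]
    {P : Polynomial (ConvergentSeries 𝕜 n)} (hP : IsWeierstrass P) (hh : Prime (ofPoly P))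
    {f g : ConvergentSeries 𝕜 (n + 1)} (hg : ¬ ofPoly P ∣ g)
    (hD : ∀ D : Derivation 𝕜 (ConvergentSeries 𝕜 (n + 1)) (ConvergentSeries 𝕜 (n + 1)),
      ofPoly P ∣ g * D f - f * D g) :
    ∃ (e : ℕ) (c : ℕ → 𝕜), c e ≠ 0 ∧
      ofPoly P ∣ ∑ j ∈ Finset.range (e + 1), c j • (f ^ j * g ^ (e - j)) := by
  classical
  have hdeg := hP.natDegree_pos hh.not_isUnit
  have hex := exists_dvd_binaryForm hP f g
  set e := Nat.find hex with he
  obtain ⟨a, ⟨j₀, hj₀, haj₀⟩, ha⟩ := Nat.find_spec hex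
  rw [← he] at hj₀ ha
  -- If the top coefficient vanishes, the form is `g` times a form of degree `e - 1`, and cancelling
  -- `g` contradicts minimality. For `e = 0` the top coefficient is the only one.
  have hmin : ∀ b : ℕ → ConvergentSeries 𝕜 n, ofPoly P ∣ binaryForm f g e b → b e = 0 →
      ∀ j ≤ e, b j = 0 := by
    intro b hb hbe
    rcases Nat.eq_zero_or_pos e with h0 | hpos
    · intro j hj
      rwa [show j = e by omega]
    · by_contra! hne
      obtain ⟨j, hj, hbj⟩ := hne
      have hje : j ≠ e := fun h => hbj (by rw [h, hbe])
      refine Nat.find_min hex (m := e - 1) (by omega) ⟨b, ⟨j, by omega, hbj⟩, ?_⟩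
      have h1 : binaryForm f g e b = g * binaryForm f g (e - 1) b := by
        rw [binaryForm, Finset.sum_range_succ, hbe, map_zero, zero_mul, add_zero, binaryForm,
          Finset.mul_sum, Nat.sub_add_cancel hpos]
        refine Finset.sum_congr rfl fun k hk => ?_
        have : e - k = (e - 1 - k) + 1 := by
          have := Finset.mem_range.1 hk
          omega
        rw [this, pow_succ]
        ring
      rw [h1] at hb
      exact (hh.dvd_or_dvd hb).resolve_left hg
  have hae : a e ≠ 0 := fun h => haj₀ (hmin a ha h j₀ hj₀)
  have hprop : ∀ j ≤ e, ∃ c : 𝕜, a j = c • a e := by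
    intro j hj
    refine exists_eq_smul_of_mul_pderiv_eq hae fun i => ?_
    have hi := dvd_binaryForm_pderiv hh hg (hP.not_dvd_pderiv_zero hdeg) hD ha i
    -- Combining the relation with its derivative makes the top coefficient `a e ∂ᵢ(a e) - a e ∂ᵢ(a
    -- e)` vanish. By minimality all these Wronskians vanish, so each `a j / a e` is a constant.
    have h1 : binaryForm f g e (fun j => a e * pderiv i (a j) - a j * pderiv i (a e)) =
        liftSucc (a e) * (binaryForm f g e fun j => pderiv i (a j)) -
          liftSucc (pderiv i (a e)) * binaryForm f g e a := by
      simp only [binaryForm]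
      rw [Finset.mul_sum, Finset.mul_sum, ← Finset.sum_sub_distrib]
      refine Finset.sum_congr rfl fun k _ => ?_
      rw [map_sub, map_mul, map_mul]
      ring
    have h2 := hmin _ (by rw [h1]; exact dvd_sub (hi.mul_left _) (ha.mul_left _)) (sub_self _) j hj
    exact sub_eq_zero.1 h2
  choose! c hc using hprop
  refine ⟨e, c, fun h => hae (by rw [hc e le_rfl, h, zero_smul]), ?_⟩
  have h1 : binaryForm f g e a =
      liftSucc (a e) * ∑ j ∈ Finset.range (e + 1), c j • (f ^ j * g ^ (e - j)) := by
    rw [binaryForm, Finset.mul_sum]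
    refine Finset.sum_congr rfl fun j hj => ?_
    rw [hc j (Nat.lt_succ_iff.1 (Finset.mem_range.1 hj)), map_smul, mul_smul_comm, smul_mul_assoc]
  rw [h1] at ha
  exact (hh.dvd_or_dvd ha).resolve_left (hP.not_dvd_liftSucc hdeg hae)

end

/-- Divided by `g ^ e`, the relation makes `f / g` algebraic over `𝕜` in the fraction field of `A /
(h)`, so it lies in the algebraically closed field `𝕜`. -/
theorem exists_dvd_sub_smul_of_dvd_sum {𝕜 A : Type*} [Field 𝕜] [IsAlgClosed 𝕜] [CommRing A]
    [Algebra 𝕜 A] {h f g : A} (hh : Prime h) (hg : ¬ h ∣ g) {e : ℕ} {c : ℕ → 𝕜} (hc : c e ≠ 0)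
    (hd : h ∣ ∑ j ∈ Finset.range (e + 1), c j • (f ^ j * g ^ (e - j))) :
    ∃ z : 𝕜, h ∣ f - z • g := by
  have hprime : (Ideal.span {h}).IsPrime := (Ideal.span_singleton_prime hh.ne_zero).2 hh
  let B := A ⧸ Ideal.span {h}
  let K := FractionRing B
  let π : A →ₐ[𝕜] K := (IsScalarTower.toAlgHom 𝕜 B K).comp (Ideal.Quotient.mkₐ 𝕜 (Ideal.span {h}))
  have hπ : ∀ x, π x = 0 ↔ h ∣ x := fun x => by
    change algebraMap B K (Ideal.Quotient.mk _ x) = 0 ↔ _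
    rw [IsFractionRing.to_map_eq_zero_iff, Ideal.Quotient.eq_zero_iff_mem,
      Ideal.mem_span_singleton]
  have hg0 : π g ≠ 0 := fun h => hg ((hπ g).1 h)
  set φ := π f / π g with hφ
  set q : Polynomial 𝕜 := ∑ j ∈ Finset.range (e + 1), Polynomial.monomial j (c j) with hq
  have hq0 : q ≠ 0 := by
    intro h0
    have := congrArg (fun p => Polynomial.coeff p e) h0
    simp [hq, Polynomial.finsetSum_coeff, Polynomial.coeff_monomial] at this
    exact hc this
  have hroot : Polynomial.aeval φ q = 0 := by
    have h1 : Polynomial.aeval φ q * π g ^ e = 0 := by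
      rw [← (hπ _).2 hd, hq, map_sum, map_sum, Finset.sum_mul]
      refine Finset.sum_congr rfl fun j hj => ?_
      have hje : π g ^ e = π g ^ j * π g ^ (e - j) := by
        rw [← pow_add]
        congr 1
        have := Finset.mem_range.1 hj
        omega
      rw [Polynomial.aeval_monomial, map_smul, Algebra.smul_def, map_mul, map_pow, map_pow, hje,
        hφ, div_pow]
      have hgj : π g ^ j ≠ 0 := pow_ne_zero _ hg0
      rw [← mul_assoc, mul_assoc (algebraMap 𝕜 K (c j)), div_mul_cancel₀ _ hgj, mul_assoc]
    exact (mul_eq_zero.1 h1).resolve_right (pow_ne_zero _ hg0)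
  have halg : IsAlgebraic 𝕜 φ := ⟨q, hq0, hroot⟩
  obtain ⟨z, hz⟩ : φ ∈ (algebraMap 𝕜 K).range :=
    minpoly.mem_range_of_degree_eq_one 𝕜 φ
      (IsAlgClosed.degree_eq_one_of_irreducible 𝕜 (minpoly.irreducible halg.isIntegral))
  refine ⟨z, (hπ _).1 ?_⟩
  rw [map_sub, map_smul, Algebra.smul_def, hz, hφ, div_mul_cancel₀ _ hg0, sub_self]

/-- If `f / g` is constant along the prime `h`, then `h` divides `f - z g` for some `z`. -/
theorem exists_dvd_sub_smul {𝕜 : Type*} [NontriviallyNormedField 𝕜] [CompleteSpace 𝕜] [CharZero 𝕜]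
    [IsAlgClosed 𝕜] : ∀ {n : ℕ} {h f g : ConvergentSeries 𝕜 n}, Prime h → ¬ h ∣ g →
    (∀ i, h ∣ g * pderiv i f - f * pderiv i g) → ∃ z : 𝕜, h ∣ f - z • g
  | 0, h, f, g, hh, _, _ => by
    refine (hh.not_isUnit (isUnit_iff.2 fun h0 => hh.ne_zero ?_)).elim
    refine Subtype.ext (MvPowerSeries.ext fun ν => ?_)
    rw [Subsingleton.elim ν 0]
    exact h0
  | n + 1, h, f, g, hh, hg, hd => by
    have hD : ∀ D : Derivation 𝕜 (ConvergentSeries 𝕜 (n + 1)) (ConvergentSeries 𝕜 (n + 1)),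
        h ∣ g * D f - f * D g := by
      intro D
      rw [derivation_eq_sum D f, derivation_eq_sum D g, Finset.mul_sum, Finset.mul_sum,
        ← Finset.sum_sub_distrib]
      refine Finset.dvd_sum fun i _ => ?_
      have : g * (D (X i) * pderiv i f) - f * (D (X i) * pderiv i g) =
          D (X i) * (g * pderiv i f - f * pderiv i g) := by ring
      rw [this]
      exact (hd i).mul_left _
    obtain ⟨p, hp, d, hreg⟩ := exists_shear_isRegularOfOrder hh.ne_zero
    obtain ⟨P, hP, -, hass⟩ := hreg.exists_associated_ofPoly
    set σ := shear p hp with hσ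
    have hdvd : ∀ x, ofPoly P ∣ σ x ↔ h ∣ x := fun x => by
      rw [hass.dvd_iff_dvd_left]
      exact map_dvd_iff σ
    have hprime : Prime (ofPoly P) :=
      hass.symm.prime ((MulEquiv.prime_iff σ.toMulEquiv).2 hh)
    obtain ⟨e, c, hc, hsum⟩ := exists_dvd_sum_smul hP hprime (f := σ f) (g := σ g)
      (by rwa [hdvd]) fun D => by
        -- Conjugating `D` by the shear gives a derivation that need not be a partial derivative,
        -- which is why `hD` covers all derivations.
        let E : Derivation 𝕜 (ConvergentSeries 𝕜 (n + 1)) (ConvergentSeries 𝕜 (n + 1)) :=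
          Derivation.mk' (σ.symm.toLinearMap.comp ((D : _ →ₗ[𝕜] _).comp σ.toLinearMap))
            fun a b => by simp
        have h1 : σ g * D (σ f) - σ f * D (σ g) = σ (g * E f - f * E g) := by
          have hE : ∀ x, σ (E x) = D (σ x) := fun x => σ.apply_symm_apply _
          rw [map_sub, map_mul, map_mul, hE, hE]
        rw [h1, hdvd]
        exact hD E
    obtain ⟨z, hz⟩ := exists_dvd_sub_smul_of_dvd_sum hprime (by rwa [hdvd]) hc hsum
    refine ⟨z, (hdvd _).1 ?_⟩
    rwa [map_sub, map_smul]

end ConvergentSeries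

/-! ### Wronskians and the form `θ` -/

namespace ConvergentSeries

section

variable {𝕜 : Type*} [NormedField 𝕜] {n : ℕ}

theorem pderiv_sub (i : Fin n) (a b : ConvergentSeries 𝕜 n) :
    pderiv i (a - b) = pderiv i a - pderiv i b :=
  map_sub (pderivDerivation i) a b

theorem pderiv_smul (i : Fin n) (c : 𝕜) (a : ConvergentSeries 𝕜 n) :
    pderiv i (c • a) = c • pderiv i a :=
  (pderivDerivation i).map_smul c a

theorem pderiv_pow_succ (i : Fin n) (a : ConvergentSeries 𝕜 n) (k : ℕ) :
    pderiv i (a ^ (k + 1)) = (k + 1 : ℕ) * a ^ k * pderiv i a := by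
  have := (pderivDerivation i).leibniz_pow a (k + 1)
  rw [nsmul_eq_mul, Nat.add_sub_cancel, smul_eq_mul, ← mul_assoc] at this
  exact this

theorem isUnit_natCast [CharZero 𝕜] {k : ℕ} (hk : k ≠ 0) :
    IsUnit (k : ConvergentSeries 𝕜 n) := by
  have h : IsUnit (k : 𝕜) := (Nat.cast_ne_zero.2 hk).isUnit
  simpa using h.map (algebraMap 𝕜 (ConvergentSeries 𝕜 n))

theorem pow_dvd_wronskian (g : ConvergentSeries 𝕜 n) {h e : ConvergentSeries 𝕜 n} {m : ℕ}
    (he : h ^ (m + 1) ∣ e) (i : Fin n) : h ^ m ∣ g * pderiv i e - e * pderiv i g := by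
  obtain ⟨s, rfl⟩ := he
  rw [pderiv_mul, pderiv_pow_succ]
  refine ⟨g * (h * pderiv i s + s * ((m + 1 : ℕ) * pderiv i h)) - h * s * pderiv i g, ?_⟩
  ring

/-- If `e = h ^ (k + 1) s`, then modulo `h ^ (k + 1)` the Wronskian is `(k + 1) g s h ^ k ∂ᵢh`. Some
`∂ᵢh` is prime to `h`, as are `g` and `k + 1`, so `h ∣ s` as long as `k < m`. -/
theorem pow_succ_dvd_of_pow_dvd_wronskian [CompleteSpace 𝕜] [CharZero 𝕜]
    {g h e : ConvergentSeries 𝕜 n} (hh : Prime h) (hg : ¬ h ∣ g) (he : h ∣ e) {m : ℕ}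
    (hd : ∀ i, h ^ m ∣ g * pderiv i e - e * pderiv i g) : h ^ (m + 1) ∣ e := by
  have key : ∀ k ≤ m, h ^ (k + 1) ∣ e := by
    intro k
    induction k with
    | zero => intro _; simpa using he
    | succ k ih =>
      intro hk
      obtain ⟨s, hs⟩ := ih (by omega)
      obtain ⟨i, hi⟩ := exists_not_dvd_pderiv hh.ne_zero hh.not_isUnit
      have h1 := (pow_dvd_pow h hk).trans (hd i)
      have h2 : g * pderiv i e - e * pderiv i g =
          h ^ k * (g * ((k + 1 : ℕ) * (s * pderiv i h))) +
            h ^ (k + 1) * (g * pderiv i s - s * pderiv i g) := by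
        rw [hs, pderiv_mul, pderiv_pow_succ]
        ring
      rw [h2, dvd_add_left (dvd_mul_right _ _), pow_succ,
        mul_dvd_mul_iff_left (pow_ne_zero _ hh.ne_zero)] at h1
      have h3 := (hh.dvd_or_dvd h1).resolve_left hg
      rw [(isUnit_natCast (Nat.succ_ne_zero k)).dvd_mul_left] at h3
      obtain ⟨t, ht⟩ := (hh.dvd_or_dvd h3).resolve_right hi
      exact ⟨t, by rw [hs, ht]; ring⟩
  exact key m le_rfl

theorem wronskian_sub_smul (f g : ConvergentSeries 𝕜 n) (c : 𝕜) (i : Fin n) :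
    g * pderiv i (f - c • g) - (f - c • g) * pderiv i g = g * pderiv i f - f * pderiv i g := by
  rw [pderiv_sub, pderiv_smul, Algebra.smul_def, Algebra.smul_def]
  ring

theorem prod_mul_derivation_prod_pow {R A ι : Type*} [CommRing R] [CommRing A] [Algebra R A]
    [DecidableEq ι] (D : Derivation R A A) (s : Finset ι) (x : ι → A) (m : ι → ℕ) :
    (∏ j ∈ s, x j) * D (∏ j ∈ s, x j ^ m j) =
      (∏ j ∈ s, x j ^ m j) * ∑ i ∈ s, m i * (∏ j ∈ s.erase i, x j) * D (x i) := by
  induction s using Finset.induction_on with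
  | empty => simp
  | insert a s ha ih =>
    have hs : ∑ i ∈ s, (m i : A) * (∏ j ∈ (insert a s).erase i, x j) * D (x i) =
        x a * ∑ i ∈ s, m i * (∏ j ∈ s.erase i, x j) * D (x i) := by
      rw [Finset.mul_sum]
      refine Finset.sum_congr rfl fun i hi => ?_
      have hai : a ≠ i := fun h => ha (h ▸ hi)
      rw [Finset.erase_insert_of_ne hai, Finset.prod_insert fun h => ha (Finset.mem_of_mem_erase h)]
      ring
    have hpow : x a * ((m a : A) * x a ^ (m a - 1)) = m a * x a ^ m a := by
      cases m a with
      | zero => simp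
      | succ k => rw [Nat.add_sub_cancel]; ring
    rw [Finset.prod_insert ha, Finset.prod_insert ha, Finset.sum_insert ha, hs,
      Finset.erase_insert ha, Derivation.leibniz, Derivation.leibniz_pow]
    simp only [smul_eq_mul, nsmul_eq_mul]
    linear_combination (x a * x a ^ m a) * ih +
      ((∏ j ∈ s, x j) * (∏ j ∈ s, x j ^ m j) * D (x a)) * hpow

namespace IrredDecomp

variable {f g : ConvergentSeries 𝕜 n}

theorem redLogDeriv_apply (F : IrredDecomp f) (k : Fin n) :
    F.redLogDeriv k = F.red * (↑F.u⁻¹ : ConvergentSeries 𝕜 n) *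
        pderiv k (F.u : ConvergentSeries 𝕜 n) +
      ∑ i, F.exponent i * (∏ j ∈ Finset.univ.erase i, F.factor j) * pderiv k (F.factor i) := by
  simp only [redLogDeriv, Pi.add_apply, Pi.smul_apply, Finset.sum_apply, smul_eq_mul]
  rfl

theorem theta_apply (F : IrredDecomp f) (G : IrredDecomp g) (k : Fin n) :
    F.theta G k = G.red * F.redLogDeriv k - F.red * G.redLogDeriv k := rfl

/-- This justifies the denominator-free formula: `redLogDeriv` is indeed `f_red df / f`. -/
theorem mul_redLogDeriv (F : IrredDecomp f) (k : Fin n) :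
    f * F.redLogDeriv k = F.red * pderiv k f := by
  have hQ := prod_mul_derivation_prod_pow (pderivDerivation k) Finset.univ F.factor F.exponent
  simp only [pderivDerivation_apply] at hQ
  have hu : (F.u : ConvergentSeries 𝕜 n) * (↑F.u⁻¹ : ConvergentSeries 𝕜 n) = 1 := F.u.mul_inv
  rw [redLogDeriv_apply]
  nth_rewrite 1 [F.eq_prod]
  rw [congrArg (pderiv k) F.eq_prod, pderiv_mul, red]
  linear_combination (-(F.u : ConvergentSeries 𝕜 n)) * hQ +
    ((∏ i, F.factor i ^ F.exponent i) * (∏ i, F.factor i) *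
      pderiv k (F.u : ConvergentSeries 𝕜 n)) * hu

theorem red_dvd (F : IrredDecomp f) : F.red ∣ f := by
  have h : F.red ∣ ∏ i, F.factor i ^ F.exponent i :=
    Finset.prod_dvd_prod_of_dvd _ _ fun i _ => dvd_pow_self _ (by have := F.exponent_pos i; omega)
  conv_rhs => rw [F.eq_prod]
  exact h.mul_left _

theorem theta_swap (F : IrredDecomp f) (G : IrredDecomp g) (k : Fin n) :
    F.theta G k = -G.theta F k := by
  rw [theta_apply, theta_apply]
  ring

theorem mul_theta (F : IrredDecomp f) (G : IrredDecomp g) (k : Fin n) :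
    f * g * F.theta G k = F.red * G.red * (g * pderiv k f - f * pderiv k g) := by
  rw [theta_apply]
  linear_combination (g * G.red) * F.mul_redLogDeriv k - (f * F.red) * G.mul_redLogDeriv k

theorem pow_dvd_theta_iff (F : IrredDecomp f) (G : IrredDecomp g) {h : ConvergentSeries 𝕜 n}
    (hh : Prime h) (hf : ¬ h ∣ f) (hg : ¬ h ∣ g) (m : ℕ) (k : Fin n) :
    h ^ m ∣ F.theta G k ↔ h ^ m ∣ g * pderiv k f - f * pderiv k g := by
  have key := F.mul_theta G k
  constructor
  · intro hd
    refine hh.pow_dvd_of_dvd_mul_left m (a := F.red * G.red) (fun hc => ?_) ?_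
    · rcases hh.dvd_or_dvd hc with h1 | h1
      · exact hf (h1.trans F.red_dvd)
      · exact hg (h1.trans G.red_dvd)
    · rw [← key]
      exact hd.mul_left _
  · intro hd
    refine hh.pow_dvd_of_dvd_mul_left m (a := f * g) (fun hc => ?_) ?_
    · exact (hh.dvd_or_dvd hc).elim hf hg
    · rw [key]
      exact hd.mul_left _

/-- Let `fᵢ` be the factor associated with `h`. Modulo `h` the only surviving term is `g_red nᵢ
(∏_{j ≠ i} fⱼ) dfᵢ`; here `nᵢ` is a unit, the other factors are prime to `h`, and some partial
derivative of `fᵢ` is too. -/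
theorem exists_not_dvd_theta [CompleteSpace 𝕜] [CharZero 𝕜] (F : IrredDecomp f)
    (G : IrredDecomp g) {h : ConvergentSeries 𝕜 n} (hh : Prime h) (hf : h ∣ f) (hg : ¬ h ∣ g) :
    ∃ k, ¬ h ∣ F.theta G k := by
  classical
  have h1 : h ∣ ∏ i, F.factor i ^ F.exponent i := by
    have : h ∣ (F.u : ConvergentSeries 𝕜 n) * ∏ i, F.factor i ^ F.exponent i := by
      rw [← F.eq_prod]
      exact hf
    rwa [F.u.isUnit.dvd_mul_left] at this
  obtain ⟨i, -, hi⟩ := (Prime.dvd_finsetProd_iff hh _).1 h1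
  have hi' : h ∣ F.factor i := hh.dvd_of_dvd_pow hi
  have hass : Associated h (F.factor i) := hh.irreducible.associated_of_dvd (F.irreducible_factor i) hi'
  have hndvd : ∀ j, j ≠ i → ¬ h ∣ F.factor j := fun j hj hd =>
    F.not_associated j i hj
      ((hh.irreducible.associated_of_dvd (F.irreducible_factor j) hd).symm.trans hass)
  obtain ⟨k, hk⟩ := exists_not_dvd_pderiv (F.irreducible_factor i).ne_zero
    (F.irreducible_factor i).not_isUnit
  refine ⟨k, fun hd => hk ?_⟩
  rw [← hass.dvd_iff_dvd_left]
  have hred : h ∣ F.red := hi'.trans (Finset.dvd_prod_of_mem _ (Finset.mem_univ i))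
  rw [theta_apply, dvd_sub_left (hred.mul_right _)] at hd
  have h2 := (hh.dvd_or_dvd hd).resolve_left fun hc => hg (hc.trans G.red_dvd)
  rw [redLogDeriv_apply, dvd_add_right ((hred.mul_right _).mul_right _),
    ← Finset.add_sum_erase _ _ (Finset.mem_univ i), dvd_add_left] at h2
  · rw [mul_assoc, (isUnit_natCast (by have := F.exponent_pos i; omega)).dvd_mul_left] at h2
    refine (hh.dvd_or_dvd h2).resolve_left fun hc => ?_
    obtain ⟨j, hj, hj'⟩ := (Prime.dvd_finsetProd_iff hh _).1 hc
    exact hndvd j (Finset.ne_of_mem_erase hj) hj'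
  · refine Finset.dvd_sum fun j hj => ?_
    refine Dvd.dvd.mul_right (Dvd.dvd.mul_left (hi'.trans (Finset.dvd_prod_of_mem _ ?_)) _) _
    exact Finset.mem_erase.2 ⟨(Finset.ne_of_mem_erase hj).symm, Finset.mem_univ i⟩

end IrredDecomp

theorem exists_isSingAlg {𝕜 : Type*} [NontriviallyNormedField 𝕜] [CompleteSpace 𝕜]
    (ω : OneForm 𝕜 n) : ∃ s, IsSingAlg ω s := by
  classical
  let _ := UniqueFactorizationMonoid.strongNormalizationMonoid (α := ConvergentSeries 𝕜 n)
  let _ := UniqueFactorizationMonoid.toNormalizedGCDMonoid (ConvergentSeries 𝕜 n)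
  exact ⟨Finset.univ.gcd ω, fun k => Finset.gcd_dvd (Finset.mem_univ k),
    fun e he => Finset.dvd_gcd fun k _ => he k⟩

theorem IsSingAlg.pow_dvd_iff {ω : OneForm 𝕜 n} {s h : ConvergentSeries 𝕜 n}
    (hs : IsSingAlg ω s) (m : ℕ) : h ^ m ∣ s ↔ ∀ k, h ^ m ∣ ω k :=
  ⟨fun hd k => hd.trans (hs.1 k), fun hd => hs.2 _ hd⟩

end

end ConvergentSeries

/-! ### Real square roots and complexification -/

namespace ConvergentSeries

variable {n : ℕ}

theorem isConvergentSeries_of_norm_coeff_le {𝕜 𝕜' : Type*} [NormedField 𝕜] [NormedField 𝕜']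
    {a : MvPowerSeries (Fin n) 𝕜} {b : MvPowerSeries (Fin n) 𝕜'} (ha : IsConvergentSeries a)
    (h : ∀ ν, ‖MvPowerSeries.coeff ν b‖ ≤ ‖MvPowerSeries.coeff ν a‖) : IsConvergentSeries b := by
  obtain ⟨r, hr, hs⟩ := ha
  exact ⟨r, hr, hs.of_nonneg_of_le (fun ν => by positivity)
    fun ν => mul_le_mul_of_nonneg_right (h ν) (by positivity)⟩

/-- A unit with positive value at the origin has a square root. -/
theorem exists_sq_eq {v : ConvergentSeries ℝ n} (hv : 0 < evalZero v) :
    ∃ w : ConvergentSeries ℝ n, w ^ 2 = v := by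
  set w₀ := √(evalZero v) with hw₀
  have hw₀pos : 0 < w₀ := Real.sqrt_pos.2 hv
  have hw₀sq : w₀ ^ 2 = evalZero v := Real.sq_sqrt hv.le
  set c := algebraMap ℝ (ConvergentSeries ℝ n) w₀ with hc
  -- At the origin `Q` becomes `X ^ 2 + 2 w₀ X`, with a simple zero at `0`. Preparation then yields
  -- a monic linear factor of `Q`, whose root shifted by `c` is the square root.
  set Q : Polynomial (ConvergentSeries ℝ n) :=
    (Polynomial.X + Polynomial.C c) ^ 2 - Polynomial.C v with hQ
  have hax : axis (ofPoly Q) =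
      ((Polynomial.X ^ 2 + Polynomial.C (2 * w₀) * Polynomial.X : Polynomial ℝ) :
        PowerSeries ℝ) := by
    rw [axis_ofPoly]
    congr 1
    rw [hQ, Polynomial.map_sub, Polynomial.map_pow, Polynomial.map_add, Polynomial.map_X,
      Polynomial.map_C, Polynomial.map_C, hc, evalZero_algebraMap, ← hw₀sq]
    simp only [map_mul, map_pow, map_ofNat]
    ring
  have hreg : IsRegularOfOrder 1 (ofPoly Q) := by
    rw [isRegularOfOrder_iff, PowerSeries.order_eq_nat, hax]
    constructor
    · rw [Polynomial.coeff_coe]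
      simp [Polynomial.coeff_X_pow, hw₀pos.ne']
    · intro i hi
      obtain rfl : i = 0 := by omega
      rw [Polynomial.coeff_coe]
      simp
  obtain ⟨P, hP, hdeg, hass⟩ := hreg.exists_associated_ofPoly
  have hPQ : P ∣ Q := hP.dvd_of_ofPoly_dvd hass.dvd
  have hPX : P = Polynomial.X + Polynomial.C (P.coeff 0) :=
    hP.monic.eq_X_add_C hdeg
  have hroot : Q.eval (-P.coeff 0) = 0 := by
    refine Polynomial.eval_eq_zero_of_dvd_of_eval_eq_zero hPQ ?_
    rw [hPX]
    simp
  refine ⟨-P.coeff 0 + c, ?_⟩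
  rw [hQ] at hroot
  simp only [Polynomial.eval_sub, Polynomial.eval_pow, Polynomial.eval_add, Polynomial.eval_X,
    Polynomial.eval_C] at hroot
  exact sub_eq_zero.1 hroot

/-- The inclusion `ℝ{x} → ℂ{x}`. -/
noncomputable def complexify : ConvergentSeries ℝ n →+* ConvergentSeries ℂ n :=
  ((MvPowerSeries.map Complex.ofRealHom).comp (ConvergentSeries ℝ n).val.toRingHom).codRestrict
    (ConvergentSeries ℂ n) fun a => isConvergentSeries_of_norm_coeff_le a.2 fun ν => by
      simp

/-- Complex conjugation of the coefficients. -/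
noncomputable def conj : ConvergentSeries ℂ n →+* ConvergentSeries ℂ n :=
  ((MvPowerSeries.map (starRingEnd ℂ)).comp (ConvergentSeries ℂ n).val.toRingHom).codRestrict
    (ConvergentSeries ℂ n) fun a => isConvergentSeries_of_norm_coeff_le a.2 fun ν => by
      simp

/-- The series of the real parts of the coefficients. -/
noncomputable def rePart (s : ConvergentSeries ℂ n) : ConvergentSeries ℝ n :=
  ⟨fun ν => (MvPowerSeries.coeff ν s.1).re,
    isConvergentSeries_of_norm_coeff_le s.2 fun _ => Complex.abs_re_le_norm _⟩

/-- The series of the imaginary parts of the coefficients. -/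
noncomputable def imPart (s : ConvergentSeries ℂ n) : ConvergentSeries ℝ n :=
  ⟨fun ν => (MvPowerSeries.coeff ν s.1).im,
    isConvergentSeries_of_norm_coeff_le s.2 fun _ => Complex.abs_im_le_norm _⟩

theorem ext_coeff {𝕜 : Type*} [NormedField 𝕜] {a b : ConvergentSeries 𝕜 n}
    (h : ∀ ν, MvPowerSeries.coeff ν a.1 = MvPowerSeries.coeff ν b.1) : a = b :=
  Subtype.ext (MvPowerSeries.ext h)

theorem coeff_complexify (a : ConvergentSeries ℝ n) (ν : Fin n →₀ ℕ) :
    MvPowerSeries.coeff ν (complexify a).1 = ((MvPowerSeries.coeff ν a.1 : ℝ) : ℂ) := rfl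

theorem coeff_conj (s : ConvergentSeries ℂ n) (ν : Fin n →₀ ℕ) :
    MvPowerSeries.coeff ν (conj s).1 = starRingEnd ℂ (MvPowerSeries.coeff ν s.1) := rfl

theorem coeff_smul {𝕜 : Type*} [NormedField 𝕜] (c : 𝕜) (a : ConvergentSeries 𝕜 n)
    (ν : Fin n →₀ ℕ) : MvPowerSeries.coeff ν (c • a).1 = c * MvPowerSeries.coeff ν a.1 := rfl

theorem complexify_injective :
    Function.Injective (complexify : ConvergentSeries ℝ n →+* ConvergentSeries ℂ n) := by
  intro a b h
  refine ext_coeff fun ν => Complex.ofReal_injective ?_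
  rw [← coeff_complexify, ← coeff_complexify, h]

theorem conj_complexify (a : ConvergentSeries ℝ n) : conj (complexify a) = complexify a :=
  ext_coeff fun ν => by rw [coeff_conj, coeff_complexify, Complex.conj_ofReal]

theorem conj_conj (s : ConvergentSeries ℂ n) : conj (conj s) = s :=
  ext_coeff fun ν => by rw [coeff_conj, coeff_conj, Complex.conj_conj]

theorem conj_smul (c : ℂ) (s : ConvergentSeries ℂ n) :
    conj (c • s) = starRingEnd ℂ c • conj s :=
  ext_coeff fun ν => by rw [coeff_conj, coeff_smul, coeff_smul, coeff_conj, map_mul]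

theorem complexify_smul (c : ℝ) (a : ConvergentSeries ℝ n) :
    complexify (c • a) = (c : ℂ) • complexify a :=
  ext_coeff fun ν => by
    rw [coeff_complexify, coeff_smul, coeff_smul, coeff_complexify, Complex.ofReal_mul]

theorem pderiv_complexify (i : Fin n) (a : ConvergentSeries ℝ n) :
    pderiv i (complexify a) = complexify (pderiv i a) :=
  ext_coeff fun ν => by
    rw [coeff_pderiv, coeff_complexify, coeff_complexify, coeff_pderiv]
    push_cast
    rfl

theorem eq_rePart_add (s : ConvergentSeries ℂ n) :
    s = complexify (rePart s) + Complex.I • complexify (imPart s) :=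
  ext_coeff fun ν => by
    refine (Complex.re_add_im _).symm.trans ?_
    rw [mul_comm]
    rfl

theorem mul_conj_of_eq {s : ConvergentSeries ℂ n} {a b : ConvergentSeries ℝ n}
    (h : s = complexify a + Complex.I • complexify b) :
    s * conj s = complexify (a ^ 2 + b ^ 2) := by
  have hI : algebraMap ℂ (ConvergentSeries ℂ n) Complex.I ^ 2 = -1 := by
    rw [← map_pow, Complex.I_sq, map_neg, map_one]
  rw [h, map_add, conj_smul, conj_complexify, conj_complexify, Complex.conj_I, map_add, map_pow,
    map_pow, Algebra.smul_def, Algebra.smul_def, map_neg]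
  linear_combination (-complexify b ^ 2) * hI

theorem mul_conj (s : ConvergentSeries ℂ n) :
    s * conj s = complexify (rePart s ^ 2 + imPart s ^ 2) :=
  mul_conj_of_eq (eq_rePart_add s)

/-- The real part of a complex quotient of two real series is again a quotient. -/
theorem complexify_dvd_iff {a b : ConvergentSeries ℝ n} :
    complexify a ∣ complexify b ↔ a ∣ b := by
  refine ⟨?_, fun h => map_dvd complexify h⟩
  rintro ⟨s, hs⟩
  have h1 := congrArg conj hs
  rw [map_mul, conj_complexify, conj_complexify] at h1
  refine ⟨rePart s, complexify_injective ?_⟩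
  have hre : s + conj s = 2 * complexify (rePart s) := by
    conv_lhs => rw [eq_rePart_add s]
    rw [map_add, conj_smul, conj_complexify, conj_complexify, Complex.conj_I, neg_smul]
    ring
  have h2 : (2 : ConvergentSeries ℂ n) ≠ 0 := by
    have := (isUnit_natCast (𝕜 := ℂ) (n := n) two_ne_zero).ne_zero
    exact_mod_cast this
  refine mul_left_cancel₀ h2 ?_
  rw [map_mul]
  linear_combination hs + h1 + complexify a * hre

theorem isUnit_complexify_iff {a : ConvergentSeries ℝ n} :
    IsUnit (complexify a) ↔ IsUnit a := by
  rw [isUnit_iff_dvd_one, isUnit_iff_dvd_one, ← complexify_dvd_iff, map_one]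

theorem isUnit_conj_iff {s : ConvergentSeries ℂ n} : IsUnit (conj s) ↔ IsUnit s := by
  refine ⟨fun h => ?_, fun h => h.map conj⟩
  rw [← conj_conj s]
  exact h.map conj

theorem irreducible_conj {s : ConvergentSeries ℂ n} (hs : Irreducible s) :
    Irreducible (conj s) := by
  refine ⟨fun h => hs.not_isUnit (isUnit_conj_iff.1 h), fun a b hab => ?_⟩
  have h1 := congrArg conj hab
  rw [conj_conj, map_mul] at h1
  exact (hs.isUnit_or_isUnit h1).imp isUnit_conj_iff.1 isUnit_conj_iff.1

/-- A complex factor of a real irreducible norm is irreducible. -/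
theorem irreducible_of_mul_conj {s : ConvergentSeries ℂ n} {N : ConvergentSeries ℝ n}
    (hN : Irreducible N) (h : s * conj s = complexify N) : Irreducible s := by
  refine ⟨fun hu => hN.not_isUnit ?_, fun a b hab => ?_⟩
  · rw [← isUnit_complexify_iff, ← h]
    exact hu.mul (hu.map conj)
  · have h1 : N = (rePart a ^ 2 + imPart a ^ 2) * (rePart b ^ 2 + imPart b ^ 2) := by
      apply complexify_injective
      rw [← h, hab, map_mul, map_mul, ← mul_conj, ← mul_conj]
      ring
    have h2 : ∀ t : ConvergentSeries ℂ n, IsUnit (rePart t ^ 2 + imPart t ^ 2) → IsUnit t := by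
      intro t ht
      rw [← isUnit_complexify_iff, ← mul_conj] at ht
      exact isUnit_of_mul_isUnit_left ht
    exact (hN.isUnit_or_isUnit h1).imp (h2 a) (h2 b)

/-- Multiply the divisibility by its conjugate. This is how divisibility by a complex factor
descends to the reals. -/
theorem dvd_sq_of_dvd_complexify {s : ConvergentSeries ℂ n} {N a : ConvergentSeries ℝ n}
    (h : s * conj s = complexify N) (hd : s ∣ complexify a) : N ∣ a ^ 2 := by
  rw [← complexify_dvd_iff, map_pow, sq, ← h]
  have h1 := map_dvd conj hd
  rw [conj_complexify] at h1
  exact mul_dvd_mul hd h1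

theorem complexify_quadratic (f g : ConvergentSeries ℝ n) (c : ℂ) :
    complexify (f ^ 2 + (‖c‖ ^ 2) • g ^ 2 - (2 * c.re) • (f * g)) =
      (complexify f - c • complexify g) *
        (complexify f - starRingEnd ℂ c • complexify g) := by
  have h1 : algebraMap ℂ (ConvergentSeries ℂ n) ((‖c‖ ^ 2 : ℝ) : ℂ) =
      algebraMap ℂ _ c * algebraMap ℂ _ (starRingEnd ℂ c) := by
    rw [← map_mul, Complex.mul_conj, Complex.normSq_eq_norm_sq]
  have h2 : algebraMap ℂ (ConvergentSeries ℂ n) ((2 * c.re : ℝ) : ℂ) =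
      algebraMap ℂ _ c + algebraMap ℂ _ (starRingEnd ℂ c) := by
    rw [← map_add, Complex.add_conj]
  rw [map_sub, map_add, complexify_smul, complexify_smul, map_mul, map_pow, map_pow,
    Algebra.smul_def, Algebra.smul_def, Algebra.smul_def, Algebra.smul_def, h1, h2]
  ring

theorem conj_sub_smul (f g : ConvergentSeries ℝ n) (c : ℂ) :
    conj (complexify f - c • complexify g) =
      complexify f - starRingEnd ℂ c • complexify g := by
  rw [map_sub, conj_smul, conj_complexify, conj_complexify]

/-- A common divisor of `f - c g` and `f - c̄ g` with `c` non-real divides `g`. -/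
theorem dvd_complexify_of_dvd_sub_smul {f g : ConvergentSeries ℝ n} {s : ConvergentSeries ℂ n}
    {c : ℂ} (hc : c.im ≠ 0) (h1 : s ∣ complexify f - c • complexify g)
    (h2 : s ∣ complexify f - starRingEnd ℂ c • complexify g) : s ∣ complexify g := by
  have h3 := dvd_sub h2 h1
  rw [sub_sub_sub_cancel_left, ← sub_smul, Algebra.smul_def] at h3
  have hne : c - starRingEnd ℂ c ≠ 0 := by
    rw [Complex.sub_conj]
    simp [hc]
  rwa [(hne.isUnit.map (algebraMap ℂ (ConvergentSeries ℂ n))).dvd_mul_left] at h3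

theorem dvd_smul_iff {𝕜 : Type*} [NormedField 𝕜] {c : 𝕜} (hc : c ≠ 0)
    {a b : ConvergentSeries 𝕜 n} : a ∣ c • b ↔ a ∣ b := by
  rw [Algebra.smul_def, (hc.isUnit.map (algebraMap 𝕜 (ConvergentSeries 𝕜 n))).dvd_mul_left]

end ConvergentSeries

/-! ### Levels of `f / g` and powers dividing the Wronskian -/

namespace ConvergentSeries

variable {n : ℕ} {f g h : ConvergentSeries ℝ n} {m : ℕ}

theorem RealLevel.pow_dvd (hfg : IsRelPrime f g) (hh : Prime h) (hl : RealLevel f g h m) :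
    ¬ h ∣ f ∧ ¬ h ∣ g ∧ ∀ i, h ^ m ∣ g * pderiv i f - f * pderiv i g := by
  obtain ⟨c, s, hc, hs⟩ := hl
  have hd : h ^ (m + 1) ∣ f - c • g := ⟨s, hs⟩
  have hd1 : h ∣ f - c • g := (dvd_pow_self h m.succ_ne_zero).trans hd
  have hfg' : h ∣ f ↔ h ∣ g := by
    rw [← dvd_smul_iff hc (b := g)]
    exact ⟨fun h1 => (dvd_sub_right h1).1 hd1, fun h1 => (dvd_sub_left h1).1 hd1⟩
  have hf : ¬ h ∣ f := fun h1 => hh.not_isUnit (hfg h1 (hfg'.1 h1))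
  refine ⟨hf, fun h1 => hf (hfg'.2 h1), fun i => ?_⟩
  rw [← wronskian_sub_smul f g c]
  exact pow_dvd_wronskian g hd i

/-- The complex prime `s = ρ₁ + i ρ₂` divides only one of `f - c g`, `f - c̄ g`, since otherwise it
divides `g`. So that factor absorbs `s ^ (m + 1)`, whence `s ^ m ∣ W`. As `W` is real and `s`, `s̄`
are coprime, `(s s̄) ^ m ∣ W`. -/
theorem NonrealLevel.pow_dvd (hfg : IsRelPrime f g) (hh : Prime h) (hl : NonrealLevel f g h m) :
    ¬ h ∣ f ∧ ¬ h ∣ g ∧ ∀ i, h ^ m ∣ g * pderiv i f - f * pderiv i g := by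
  obtain ⟨c, ρ₁, ρ₂, ς₁, ς₂, hc, hρ, heq⟩ := hl
  set N := ρ₁ ^ 2 + ρ₂ ^ 2 with hN
  have hass : Associated h N := by
    rcases hρ with h1 | h1
    · rw [h1]
    · rw [h1]
      exact (Associated.refl N).neg_left
  have hNp : Prime N := hass.prime hh
  have hNq : N ∣ f ^ 2 + (‖c‖ ^ 2) • g ^ 2 - (2 * c.re) • (f * g) := by
    rw [heq]
    exact (dvd_pow_self N m.succ_ne_zero).mul_right _
  have hc0 : ‖c‖ ^ 2 ≠ 0 := by
    refine pow_ne_zero _ (norm_ne_zero_iff.2 ?_)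
    rintro rfl
    exact hc rfl
  have hfg' : N ∣ f ↔ N ∣ g := by
    constructor
    · intro h1
      have h2 : N ∣ (2 * c.re) • (f * g) := by
        rw [Algebra.smul_def]
        exact (h1.mul_right _).mul_left _
      rw [dvd_sub_left h2, dvd_add_right (h1.pow two_ne_zero), dvd_smul_iff hc0] at hNq
      exact hNp.dvd_of_dvd_pow hNq
    · intro h1
      have h2 : N ∣ (2 * c.re) • (f * g) := by
        rw [Algebra.smul_def]
        exact (h1.mul_left _).mul_left _
      rw [dvd_sub_left h2, dvd_add_left ((dvd_smul_iff hc0).2 (h1.pow two_ne_zero))] at hNq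
      exact hNp.dvd_of_dvd_pow hNq
  have hf : ¬ N ∣ f := fun h1 => hNp.not_isUnit (hfg h1 (hfg'.1 h1))
  have hg : ¬ N ∣ g := fun h1 => hf (hfg'.2 h1)
  refine ⟨by rwa [hass.dvd_iff_dvd_left], by rwa [hass.dvd_iff_dvd_left], fun i => ?_⟩
  rw [(hass.pow_pow (n := m)).dvd_iff_dvd_left]
  set s := complexify ρ₁ + Complex.I • complexify ρ₂ with hs
  have hsN : s * conj s = complexify N := mul_conj_of_eq hs
  have hsp : Prime s := (irreducible_of_mul_conj hNp.irreducible hsN).prime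
  have hsg : ¬ s ∣ complexify g := fun h1 =>
    hg (hNp.dvd_of_dvd_pow (dvd_sq_of_dvd_complexify hsN h1))
  have hprod : s ^ (m + 1) ∣ (complexify f - c • complexify g) *
      (complexify f - starRingEnd ℂ c • complexify g) := by
    rw [← complexify_quadratic, heq, map_mul, map_pow, ← hsN, mul_pow, mul_assoc]
    exact dvd_mul_right _ _
  obtain ⟨c', hc', hd⟩ : ∃ c' : ℂ, c'.im ≠ 0 ∧
      s ^ (m + 1) ∣ complexify f - c' • complexify g := by
    by_cases h1 : s ∣ complexify f - c • complexify g
    · refine ⟨c, hc, hsp.pow_dvd_of_dvd_mul_right _ (fun h2 => ?_) hprod⟩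
      exact hsg (dvd_complexify_of_dvd_sub_smul hc h1 h2)
    · exact ⟨starRingEnd ℂ c, by simpa using hc, hsp.pow_dvd_of_dvd_mul_left _ h1 hprod⟩
  have hd1 : s ∣ complexify f - c' • complexify g := (dvd_pow_self s m.succ_ne_zero).trans hd
  have hncd : ¬ s ∣ conj s := fun h1 => by
    have h2 := h1.trans (map_dvd conj hd1)
    rw [conj_sub_smul] at h2
    exact hsg (dvd_complexify_of_dvd_sub_smul hc' hd1 h2)
  have hw : s ^ m ∣ complexify (g * pderiv i f - f * pderiv i g) := by
    have := pow_dvd_wronskian (complexify g) hd i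
    rw [wronskian_sub_smul, pderiv_complexify, pderiv_complexify] at this
    rwa [map_sub, map_mul, map_mul]
  have hw' : conj s ^ m ∣ complexify (g * pderiv i f - f * pderiv i g) := by
    have := map_dvd conj hw
    rwa [map_pow, conj_complexify] at this
  rw [← complexify_dvd_iff, map_pow, ← hsN, mul_pow]
  obtain ⟨t, ht⟩ := hw'
  rw [ht, mul_comm (conj s ^ m)] at hw
  rw [ht, mul_comm]
  refine mul_dvd_mul_left _ (hsp.pow_dvd_of_dvd_mul_right m ?_ hw)
  exact fun h1 => hncd (hsp.dvd_of_dvd_pow h1)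

/-- A real irreducible `h` divides the norm of each of its complex factors. -/
theorem dvd_of_mul_conj {s : ConvergentSeries ℂ n} {N : ConvergentSeries ℝ n} (hh : Prime h)
    (hs : ¬ IsUnit s) (hN : s * conj s = complexify N) (hd : s ∣ complexify h) : h ∣ N := by
  obtain ⟨t, ht⟩ := dvd_sq_of_dvd_complexify hN hd
  rcases hh.dvd_or_dvd (show h ∣ N * t by rw [← ht]; exact dvd_pow_self h two_ne_zero) with h1 | h1
  · exact h1
  -- Here `h² = N h v`, so `h = N v`. Since `N` is not a unit, `v` is one.
  · obtain ⟨v, rfl⟩ := h1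
    have h2 : h = N * v := by
      refine mul_left_cancel₀ hh.ne_zero ?_
      linear_combination ht
    rcases hh.irreducible.isUnit_or_isUnit h2 with h3 | h3
    · rw [← isUnit_complexify_iff, ← hN] at h3
      exact (hs (isUnit_of_mul_isUnit_left h3)).elim
    · rw [h2, h3.mul_right_dvd]

theorem level_of_pow_dvd (hh : Prime h) (hf : ¬ h ∣ f) (hg : ¬ h ∣ g) (hm : 1 ≤ m)
    (hd : ∀ i, h ^ m ∣ g * pderiv i f - f * pderiv i g) :
    RealLevel f g h m ∨ NonrealLevel f g h m := by
  obtain ⟨s, hsirr, hsh⟩ := WfDvdMonoid.exists_irreducible_factor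
    (a := complexify h) (fun h1 => hh.not_isUnit (isUnit_complexify_iff.1 h1))
    (fun h1 => hh.ne_zero (complexify_injective (by rw [h1, map_zero])))
  have hsp : Prime s := hsirr.prime
  set N := rePart s ^ 2 + imPart s ^ 2 with hN
  have hsN : s * conj s = complexify N := mul_conj s
  have hhN : h ∣ N := dvd_of_mul_conj hh hsirr.not_isUnit hsN hsh
  have hreal : ∀ b, s ∣ complexify b → h ∣ b := fun b hb =>
    hh.dvd_of_dvd_pow (hhN.trans (dvd_sq_of_dvd_complexify hsN hb))
  have hsg : ¬ s ∣ complexify g := fun h1 => hg (hreal g h1)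
  have hsw : ∀ i, s ^ m ∣ complexify g * pderiv i (complexify f) -
      complexify f * pderiv i (complexify g) := fun i => by
    rw [pderiv_complexify, pderiv_complexify, ← map_mul, ← map_mul, ← map_sub]
    refine (pow_dvd_pow_of_dvd hsh m).trans ?_
    rw [← map_pow]
    exact map_dvd complexify (hd i)
  obtain ⟨c, hc⟩ := exists_dvd_sub_smul hsp hsg fun i =>
    (dvd_pow_self s (by omega)).trans (hsw i)
  by_cases hcim : c.im = 0
  · left
    have hcre : c = (c.re : ℂ) := Complex.ext rfl (by simp [hcim])
    rw [hcre, ← complexify_smul, ← map_sub] at hc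
    have h1 := hreal _ hc
    have hc0 : c.re ≠ 0 := by
      intro h0
      rw [h0, zero_smul, sub_zero] at h1
      exact hf h1
    obtain ⟨t, ht⟩ := pow_succ_dvd_of_pow_dvd_wronskian hh hg h1 fun i => by
      rw [wronskian_sub_smul]
      exact hd i
    exact ⟨c.re, t, hc0, ht⟩
  · right
    obtain ⟨b, hb⟩ := hhN
    -- With `h = s a`, the irreducible `s̄` equals `a b`. If `a` were a unit, `h` would divide `f -
    -- c g` and, being real, also `f - c̄ g`, hence `g`.
    have hbu : IsUnit b := by
      obtain ⟨a, ha⟩ := hsh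
      have h1 : conj s = a * complexify b := by
        refine mul_left_cancel₀ hsp.ne_zero ?_
        rw [hsN, hb, map_mul, ha, mul_assoc]
      rcases (irreducible_conj hsirr).isUnit_or_isUnit h1 with hu | hu
      · have h2 : complexify h ∣ complexify f - c • complexify g := by
          rw [ha, hu.mul_right_dvd]
          exact hc
        have h3 := map_dvd conj h2
        rw [conj_sub_smul, conj_complexify] at h3
        exact (hg (complexify_dvd_iff.1 (dvd_complexify_of_dvd_sub_smul hcim h2 h3))).elim
      · exact isUnit_complexify_iff.1 hu
    obtain ⟨u, rfl⟩ := hbu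
    set v : ConvergentSeries ℝ n := ↑u⁻¹ with hv
    have hvh : h = v * N := by rw [hb, hv, mul_comm, mul_assoc, Units.mul_inv, mul_one]
    have hv0 : evalZero v ≠ 0 := isUnit_iff.1 u⁻¹.isUnit
    -- The unit relating `h` to the norm of `s` is plus or minus a square; replacing `s` by `w s`
    -- absorbs it and leaves only the sign.
    obtain ⟨w, hw⟩ : ∃ w : ConvergentSeries ℝ n, v = w ^ 2 ∨ v = -w ^ 2 := by
      rcases hv0.lt_or_gt with h1 | h1
      · obtain ⟨w, hw⟩ := exists_sq_eq (v := -v) (by rw [map_neg]; linarith)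
        exact ⟨w, Or.inr (by rw [hw, neg_neg])⟩
      · obtain ⟨w, hw⟩ := exists_sq_eq h1
        exact ⟨w, Or.inl hw.symm⟩
    have hwu : IsUnit w := by
      have : IsUnit (w ^ 2) := by
        rcases hw with h1 | h1
        · rw [← h1]
          exact u⁻¹.isUnit
        · rw [← neg_neg (w ^ 2), ← h1]
          exact u⁻¹.isUnit.neg
      exact (isUnit_pow_iff two_ne_zero).1 this
    have hdvd : s ^ (m + 1) ∣ complexify f - c • complexify g :=
      pow_succ_dvd_of_pow_dvd_wronskian hsp hsg hc fun i => by
        rw [wronskian_sub_smul]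
        exact hsw i
    have hdvd' : (complexify w * s) ^ (m + 1) ∣ complexify f - c • complexify g := by
      rw [mul_pow, ((hwu.map complexify).pow (m + 1)).mul_left_dvd]
      exact hdvd
    obtain ⟨t, ht⟩ := hdvd'
    refine ⟨c, w * rePart s, w * imPart s, rePart t, imPart t, hcim, ?_, ?_⟩
    · have h1 : (w * rePart s) ^ 2 + (w * imPart s) ^ 2 = w ^ 2 * N := by rw [hN]; ring
      rw [h1, hvh]
      exact hw.imp (fun h2 => by rw [h2]) fun h2 => by rw [h2]; ring
    · apply complexify_injective
      rw [complexify_quadratic, ← conj_sub_smul, ht, map_mul, map_pow, map_mul, map_mul,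
        conj_complexify, ← mul_conj t, map_pow]
      have h1 : complexify ((w * rePart s) ^ 2 + (w * imPart s) ^ 2) =
          complexify w ^ 2 * (s * conj s) := by
        rw [hsN, ← map_pow, ← map_mul, hN]
        congr 1
        ring
      rw [h1]
      ring

theorem IrredDecomp.pow_dvd_theta_iff_level (hfg : IsRelPrime f g) (F : IrredDecomp f)
    (G : IrredDecomp g) (hh : Prime h) (hm : 1 ≤ m) :
    (∀ k, h ^ m ∣ F.theta G k) ↔ RealLevel f g h m ∨ NonrealLevel f g h m := by
  constructor
  · intro hd
    have hd1 : ∀ k, h ∣ F.theta G k := fun k => (dvd_pow_self h (by omega)).trans (hd k)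
    have hnot : ¬ (h ∣ f ∧ h ∣ g) := fun h1 => hh.not_isUnit (hfg h1.1 h1.2)
    have hf : ¬ h ∣ f := fun h1 => by
      obtain ⟨k, hk⟩ := F.exists_not_dvd_theta G hh h1 fun h2 => hnot ⟨h1, h2⟩
      exact hk (hd1 k)
    have hg : ¬ h ∣ g := fun h1 => by
      obtain ⟨k, hk⟩ := G.exists_not_dvd_theta F hh h1 hf
      obtain ⟨t, ht⟩ := hd1 k
      exact hk ⟨-t, by rw [G.theta_swap F, ht]; ring⟩
    exact level_of_pow_dvd hh hf hg hm fun i => (F.pow_dvd_theta_iff G hh hf hg m i).1 (hd i)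
  · intro hl
    obtain ⟨hf, hg, hd⟩ := hl.elim (fun h1 => h1.pow_dvd hfg hh) fun h1 => h1.pow_dvd hfg hh
    exact fun k => (F.pow_dvd_theta_iff G hh hf hg m k).2 (hd k)

end ConvergentSeries

/-! ### The main theorem -/

theorem mainTheorem3 {n : ℕ} (f g : ConvergentSeries ℝ n) (hfg : IsRelPrime f g)
    (F : ConvergentSeries.IrredDecomp f) (G : ConvergentSeries.IrredDecomp g)
    (h : ConvergentSeries ℝ n) (hh : Irreducible h) (l : ℕ) (hl : 1 ≤ l) :
    ConvergentSeries.IsSingAlgComponent (F.theta G) h l ↔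
      IsGreatest {m : ℕ | ConvergentSeries.RealLevel f g h m ∨
        ConvergentSeries.NonrealLevel f g h m} l := by
  -- At `m = 0` the left side is vacuous and the equivalence can fail. Since `1 ≤ l`, it is only
  -- needed at `l` and at exponents above `l`.
  have key : ∀ m, 1 ≤ m → ((∀ k, h ^ m ∣ F.theta G k) ↔
      ConvergentSeries.RealLevel f g h m ∨ ConvergentSeries.NonrealLevel f g h m) :=
    fun m hm => F.pow_dvd_theta_iff_level hfg G hh.prime hm
  constructor
  · rintro ⟨-, -, s, hs, h1, h2⟩
    rw [hs.pow_dvd_iff] at h1 h2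
    refine ⟨(key l hl).1 h1, fun m hm => ?_⟩
    by_contra hlt
    rw [not_le] at hlt
    exact h2 fun k => (pow_dvd_pow h hlt).trans ((key m (by omega)).2 hm k)
  · rintro ⟨h1, h2⟩
    obtain ⟨s, hs⟩ := ConvergentSeries.exists_isSingAlg (F.theta G)
    refine ⟨hh, hl, s, hs, (hs.pow_dvd_iff l).2 ((key l hl).2 h1), fun h3 => ?_⟩
    have := h2 ((key (l + 1) (by omega)).1 ((hs.pow_dvd_iff _).1 h3))
    omega
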